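/- All monoidal categories and functors are strict. A hypergraph category is a symmetric monoidal category in which every object $X$ carries a commutative comonoid (copy $X\to X\otimes X$, delete $X\to I$) and a commutative monoid (compare $X\otimes X\to X$, omni $I\to X$), both compatible with the monoidal structure, which together satisfy the laws of special Frobenius algebras. $\mathbf{HypCat}$ is the category of hypergraph categories and hypergraph functors (symmetric monoidal functors preserving copy, delete, compare and omni). $\mathbf{OUGr}$ is the category whose objects are finite undirected graphs with a total order on the vertices, and whose morphisms $\alpha\colon\mathcal H\to\mathcal H'$ are the (weakly) monotone maps $V_{\mathcal H}\to V_{\mathcal H'}$ such that for every edge $\{x,y\}$ of $\mathcal H$ either $\alpha(x)=\alpha(y)$ or $\{\alpha(x),\alpha(y)\}$ is an edge of $\mathcal H'$. For a graph $\mathcal H$ in $\mathbf{OUGr}$ let $\mathsf{Syn}_{\mathcal H}$ be the free hypergraph category on the signature whose generating objects are the vertices of $\mathcal H$ and which has one generating morphism $\phi_C\colon I\to C$ for every nonempty clique $C$ of $\mathcal H$ (singletons count as cliques; a set of vertices, used as an object, denotes the tensor product of its elements in increasing order). For a finite set $S$ of such generators let $\mathrm{Out}(S)$ be the union of their cliques,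 and let $\mathrm{comp}(S)\colon I\to\mathrm{Out}(S)$ be their compare-composition: $\mathrm{comp}(\emptyset)=\mathrm{id}_I$, and $\mathrm{comp}(S)$ is obtained, for any $\phi\in S$, by putting $\phi$ beside $\mathrm{comp}(S\setminus\{\phi\})$ and comparing the outputs that they share (up to the permutation that puts the outputs in increasing order). The result does not depend on the choices of $\phi$. **Theorem.** There is a contravariant functor $\mathbf{OUGr}\to\mathbf{HypCat}$ that sends every $\mathcal H$ to $\mathsf{Syn}_{\mathcal H}$, and every morphism $\alpha\colon\mathcal H\to\mathcal H'$ to a hypergraph functor $\mathsf{Syn}_\alpha\colon\mathsf{Syn}_{\mathcal H'}\to\mathsf{Syn}_{\mathcal H}$ such that 1. $\mathsf{Syn}_\alpha(v)=\alpha^{-1}(v)$ for every vertex $v$ of $\mathcal H'$; 2. for every nonempty clique $C$ of $\mathcal H'$, $\mathsf{Syn}_\alpha(\phi_C)\colon I\to\alpha^{-1}(C)$ is the compare-composition of $S_C=\{\phi_D : D \text{ a nonempty clique of }\mathcal H,\ \alpha(D)=C\}$, tensored with omni on the vertices in $\alpha^{-1}(C)\setminus\mathrm{Out}(S_C)$ (up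 to the permutation that puts the outputs in increasing order). -/

import Mathlib

open CategoryTheory MonoidalCategory Opposite

universe v u v₁ u₁ v₂ u₂ v₃ u₃

/-! ### Strict hypergraph categories and the category they form -/

/-- A monoidal category is strict: the tensor product is associative and unital on the nose,
and associators and unitors are identities (as morphisms between propositionally equal objects,
identities are written `eqToHom`). -/
class StrictMonoidal (C : Type u) [Category.{v} C] [MonoidalCategory C] : Prop where
  tensor_assoc : ∀ X Y Z : C, (X ⊗ Y) ⊗ Z = X ⊗ (Y ⊗ Z)
  unit_tensor : ∀ X : C, 𝟙_ C ⊗ X = X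
  tensor_unit : ∀ X : C, X ⊗ 𝟙_ C = X
  associator_hom : ∀ X Y Z : C, (α_ X Y Z).hom = eqToHom (tensor_assoc X Y Z)
  leftUnitor_hom : ∀ X : C, (λ_ X).hom = eqToHom (unit_tensor X)
  rightUnitor_hom : ∀ X : C, (ρ_ X).hom = eqToHom (tensor_unit X)

/-- A hypergraph category: a CD-category (Mathlib's `CopyDiscardCategory`: symmetric monoidal with
a compatible commutative comonoid `copy = comul`, `delete = counit` on every object) in which every
object also carries a commutative monoid (`compare = mul`, `omni = one`), compatible with the
monoidal structure, such that the comonoid and the monoid form a special Frobenius algebra. -/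
class HypergraphCategory (C : Type u) [Category.{v} C] [MonoidalCategory C]
    extends CopyDiscardCategory C where
  [monObj : (X : C) → MonObj X]
  [isCommMonObj : (X : C) → IsCommMonObj X]
  compare_tensor : ∀ X Y : C,
    MonObj.mul (X := X ⊗ Y) = tensorμ X Y X Y ≫ (MonObj.mul (X := X) ⊗ₘ MonObj.mul (X := Y))
  omni_tensor : ∀ X Y : C,
    MonObj.one (X := X ⊗ Y) = (λ_ (𝟙_ C)).inv ≫ (MonObj.one (X := X) ⊗ₘ MonObj.one (X := Y))
  compare_unit : MonObj.mul (X := 𝟙_ C) = (λ_ (𝟙_ C)).hom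
  omni_unit : MonObj.one (X := 𝟙_ C) = 𝟙 (𝟙_ C)
  /-- specialness -/
  special : ∀ X : C, ComonObj.comul (X := X) ≫ MonObj.mul (X := X) = 𝟙 X
  /-- the two Frobenius equations -/
  frobenius_left : ∀ X : C,
    (ComonObj.comul (X := X) ▷ X) ≫ (α_ X X X).hom ≫ (X ◁ MonObj.mul (X := X)) =
      MonObj.mul (X := X) ≫ ComonObj.comul (X := X)
  frobenius_right : ∀ X : C,
    (X ◁ ComonObj.comul (X := X)) ≫ (α_ X X X).inv ≫ (MonObj.mul (X := X) ▷ X) =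
      MonObj.mul (X := X) ≫ ComonObj.comul (X := X)

attribute [reducible] HypergraphCategory.monObj
attribute [instance] HypergraphCategory.monObj HypergraphCategory.isCommMonObj

section maps
variable {C : Type u} [Category.{v} C] [MonoidalCategory C] [HypergraphCategory C]

/-- The copy map of an object. -/
abbrev copyMap (X : C) : X ⟶ X ⊗ X := ComonObj.comul
/-- The delete map of an object. -/
abbrev delMap (X : C) : X ⟶ 𝟙_ C := ComonObj.counit
/-- The compare map of an object. -/
abbrev compareMap (X : C) : X ⊗ X ⟶ X := MonObj.mul
/-- The omni map of an object. -/
abbrev omniMap (X : C) : 𝟙_ C ⟶ X := MonObj.one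

end maps

/-- A hypergraph functor: a strict symmetric monoidal functor preserving copy, delete, compare and
omni. Strictness means that the coherence morphisms are identities (`eqToHom`). -/
structure HypFunctor (C : Type u₁) [Category.{v₁} C] [MonoidalCategory C] [HypergraphCategory C]
    (D : Type u₂) [Category.{v₂} D] [MonoidalCategory D] [HypergraphCategory D]
    extends Functor C D where
  obj_unit : obj (𝟙_ C) = 𝟙_ D
  obj_tensor : ∀ X Y : C, obj (X ⊗ Y) = obj X ⊗ obj Y
  map_tensor : ∀ {X Y X' Y' : C} (f : X ⟶ Y) (g : X' ⟶ Y'),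
    map (f ⊗ₘ g) =
      eqToHom (obj_tensor X X') ≫ (map f ⊗ₘ map g) ≫ eqToHom (obj_tensor Y Y').symm
  map_braiding : ∀ X Y : C,
    map (β_ X Y).hom =
      eqToHom (obj_tensor X Y) ≫ (β_ (obj X) (obj Y)).hom ≫ eqToHom (obj_tensor Y X).symm
  map_copy : ∀ X : C, map (copyMap X) = copyMap (obj X) ≫ eqToHom (obj_tensor X X).symm
  map_del : ∀ X : C, map (delMap X) = delMap (obj X) ≫ eqToHom obj_unit.symm
  map_compare : ∀ X : C, map (compareMap X) = eqToHom (obj_tensor X X) ≫ compareMap (obj X)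
  map_omni : ∀ X : C, map (omniMap X) = eqToHom obj_unit ≫ omniMap (obj X)

namespace HypFunctor

variable {C : Type u₁} [Category.{v₁} C] [MonoidalCategory C] [HypergraphCategory C]
  {D : Type u₂} [Category.{v₂} D] [MonoidalCategory D] [HypergraphCategory D]
  {E : Type u₃} [Category.{v₃} E] [MonoidalCategory E] [HypergraphCategory E]

theorem ext_functor {F G : HypFunctor C D} (h : F.toFunctor = G.toFunctor) : F = G := by
  cases F; cases G; cases h; rfl

/-- The identity hypergraph functor. -/
def id (C : Type u₁) [Category.{v₁} C] [MonoidalCategory C] [HypergraphCategory C] :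
    HypFunctor C C where
  toFunctor := Functor.id C
  obj_unit := rfl
  obj_tensor _ _ := rfl
  map_tensor := by intros; simp
  map_braiding := by intros; simp
  map_copy := by intros; simp
  map_del := by intros; simp
  map_compare := by intros; simp
  map_omni := by intros; simp

/-- Composition of hypergraph functors. -/
def comp (F : HypFunctor C D) (G : HypFunctor D E) : HypFunctor C E where
  toFunctor := F.toFunctor ⋙ G.toFunctor
  obj_unit := (congrArg G.obj F.obj_unit).trans G.obj_unit
  obj_tensor X Y := (congrArg G.obj (F.obj_tensor X Y)).trans (G.obj_tensor _ _)
  map_tensor f g := by simp [F.map_tensor, G.map_tensor, eqToHom_map]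
  map_braiding X Y := by simp [F.map_braiding, G.map_braiding, eqToHom_map]
  map_copy X := by simp [F.map_copy, G.map_copy, eqToHom_map]
  map_del X := by simp [F.map_del, G.map_del, eqToHom_map]
  map_compare X := by simp [F.map_compare, G.map_compare, eqToHom_map]
  map_omni X := by simp [F.map_omni, G.map_omni, eqToHom_map]

end HypFunctor

/-- The objects of the category of (strict) hypergraph categories. -/
structure HypCat where
  carrier : Type u
  [category : Category.{v} carrier]
  [monoidal : MonoidalCategory carrier]
  [hypergraph : HypergraphCategory carrier]
  [strict : StrictMonoidal carrier]

namespace HypCat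

attribute [instance] category monoidal hypergraph strict

/-- Hypergraph categories and hypergraph functors form a category. -/
instance : Category HypCat.{v, u} where
  Hom C D := HypFunctor C.carrier D.carrier
  id C := HypFunctor.id C.carrier
  comp F G := F.comp G
  id_comp _ := HypFunctor.ext_functor rfl
  comp_id _ := HypFunctor.ext_functor rfl
  assoc _ _ _ := HypFunctor.ext_functor rfl

end HypCat

/-! ### The free hypergraph category on a monoidal signature -/

/-- A monoidal signature: generating objects, and generating morphisms typed in finite lists
of generating objects. -/
structure MonSig where
  Ob : Type u
  Gen : Type u
  dom : Gen → List Ob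
  cod : Gen → List Ob

/-- Formal string diagrams over a signature: sequential and parallel composites of the generators
and of the structural maps. -/
inductive Term (S : MonSig.{u}) : List S.Ob → List S.Ob → Type u
  | id (x) : Term S x x
  | comp {x y z} : Term S x y → Term S y z → Term S x z
  | tensor {x y x' y'} : Term S x y → Term S x' y' → Term S (x ++ x') (y ++ y')
  | swap (x y) : Term S (x ++ y) (y ++ x)
  | copy (x) : Term S x (x ++ x)
  | del (x) : Term S x []
  | compare (x) : Term S (x ++ x) x
  | omni (x) : Term S [] x
  | gen (g : S.Gen) : Term S (S.dom g) (S.cod g)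

namespace Term

variable {S : MonSig.{u}}

/-- The identity diagram between two equal words. -/
def ofEq {x y : List S.Ob} (h : x = y) : Term S x y := h ▸ Term.id x

theorem append_four {α : Type u} (x y z w : List α) :
    (x ++ y) ++ (z ++ w) = (x ++ (y ++ z)) ++ w := by
  simp

/-- `id ⊗ swap ⊗ id`, exchanging the two middle words. -/
def middle (x y z w : List S.Ob) : Term S ((x ++ y) ++ (z ++ w)) ((x ++ z) ++ (y ++ w)) :=
  (ofEq (append_four x y z w)).comp
    ((((Term.id x).tensor (swap y z)).tensor (Term.id w)).comp
      (ofEq (append_four x z y w).symm))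

/-- The congruence on formal string diagrams generated by the laws of strict hypergraph
categories. Structural maps are available on all words; by the compatibility of the structure
with the tensor product (`swap_append`, `copy_append`, `copy_nil`, ...) those on a word are the
composites of those on its letters. -/
inductive Rel : {x y : List S.Ob} → Term S x y → Term S x y → Prop
  -- congruence
  | refl {x y} (f : Term S x y) : Rel f f
  | symm {x y} {f g : Term S x y} : Rel f g → Rel g f
  | trans {x y} {f g h : Term S x y} : Rel f g → Rel g h → Rel f h
  | comp_congr {x y z} {f f' : Term S x y} {g g' : Term S y z} :
      Rel f f' → Rel g g' → Rel (f.comp g) (f'.comp g')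
  | tensor_congr {x y x' y'} {f f' : Term S x y} {g g' : Term S x' y'} :
      Rel f f' → Rel g g' → Rel (f.tensor g) (f'.tensor g')
  -- strict monoidal categories
  | id_comp {x y} (f : Term S x y) : Rel ((Term.id x).comp f) f
  | comp_id {x y} (f : Term S x y) : Rel (f.comp (Term.id y)) f
  | assoc {x y z w} (f : Term S x y) (g : Term S y z) (h : Term S z w) :
      Rel ((f.comp g).comp h) (f.comp (g.comp h))
  | tensor_id (x y) : Rel ((Term.id x).tensor (Term.id y)) (Term.id (x ++ y))
  | tensor_comp {x y z x' y' z'} (f : Term S x y) (g : Term S y z)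
      (f' : Term S x' y') (g' : Term S y' z') :
      Rel ((f.comp g).tensor (f'.comp g')) ((f.tensor f').comp (g.tensor g'))
  | tensor_assoc {x y x' y' x'' y''}
      (f : Term S x y) (g : Term S x' y') (h : Term S x'' y'') :
      Rel (((f.tensor g).tensor h).comp (ofEq (List.append_assoc y y' y'')))
        ((ofEq (List.append_assoc x x' x'')).comp (f.tensor (g.tensor h)))
  | nil_tensor {x y} (f : Term S x y) : Rel ((Term.id []).tensor f) f
  | tensor_nil {x y} (f : Term S x y) :
      Rel ((f.tensor (Term.id [])).comp (ofEq (List.append_nil y)))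
        ((ofEq (List.append_nil x)).comp f)
  -- symmetry
  | swap_natural {x y x' y'} (f : Term S x y) (g : Term S x' y') :
      Rel ((f.tensor g).comp (swap y y')) ((swap x x').comp (g.tensor f))
  | swap_swap (x y) : Rel ((swap x y).comp (swap y x)) (Term.id (x ++ y))
  | swap_append (x y z) :
      Rel (swap x (y ++ z))
        ((ofEq (List.append_assoc x y z).symm).comp
          (((swap x y).tensor (Term.id z)).comp
            ((ofEq (List.append_assoc y x z)).comp
              (((Term.id y).tensor (swap x z)).comp
                (ofEq (List.append_assoc y z x).symm)))))
  -- commutative comonoids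
  | copy_del_left (x) : Rel ((copy x).comp ((del x).tensor (Term.id x))) (Term.id x)
  | copy_del_right (x) :
      Rel (((copy x).comp ((Term.id x).tensor (del x))).comp (ofEq (List.append_nil x)))
        (Term.id x)
  | copy_assoc (x) :
      Rel (((copy x).comp ((copy x).tensor (Term.id x))).comp (ofEq (List.append_assoc x x x)))
        ((copy x).comp ((Term.id x).tensor (copy x)))
  | copy_comm (x) : Rel ((copy x).comp (swap x x)) (copy x)
  | copy_append (x y) :
      Rel (copy (x ++ y)) (((copy x).tensor (copy y)).comp (middle x x y y))
  | copy_nil : Rel (copy []) (Term.id [])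
  | del_append (x y) : Rel (del (x ++ y)) ((del x).tensor (del y))
  | del_nil : Rel (del []) (Term.id [])
  -- commutative monoids
  | omni_compare_left (x) : Rel (((omni x).tensor (Term.id x)).comp (compare x)) (Term.id x)
  | omni_compare_right (x) :
      Rel (((Term.id x).tensor (omni x)).comp (compare x)) (ofEq (List.append_nil x))
  | compare_assoc (x) :
      Rel (((compare x).tensor (Term.id x)).comp (compare x))
        ((ofEq (List.append_assoc x x x)).comp
          (((Term.id x).tensor (compare x)).comp (compare x)))
  | compare_comm (x) : Rel ((swap x x).comp (compare x)) (compare x)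
  | compare_append (x y) :
      Rel (compare (x ++ y)) ((middle x y x y).comp ((compare x).tensor (compare y)))
  | compare_nil : Rel (compare []) (Term.id [])
  | omni_append (x y) : Rel (omni (x ++ y)) ((omni x).tensor (omni y))
  | omni_nil : Rel (omni []) (Term.id [])
  -- special Frobenius algebras
  | special (x) : Rel ((copy x).comp (compare x)) (Term.id x)
  | frobenius_left (x) :
      Rel (((copy x).tensor (Term.id x)).comp
          ((ofEq (List.append_assoc x x x)).comp ((Term.id x).tensor (compare x))))
        ((compare x).comp (copy x))
  | frobenius_right (x) :
      Rel (((Term.id x).tensor (copy x)).comp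
          ((ofEq (List.append_assoc x x x).symm).comp ((compare x).tensor (Term.id x))))
        ((compare x).comp (copy x))

instance setoid (x y : List S.Ob) : Setoid (Term S x y) :=
  ⟨Rel, Rel.refl, Rel.symm, Rel.trans⟩

end Term

/-- The free hypergraph category on a signature: its objects are words in the generating objects,
its morphisms are formal string diagrams modulo the laws of strict hypergraph categories. -/
def FreeHyp (S : MonSig.{u}) : Type u := List S.Ob

namespace FreeHyp

variable {S : MonSig.{u}}

/-- A word of generating objects, as an object. -/
def word (w : List S.Ob) : FreeHyp S := w

instance : Category.{u} (FreeHyp S) where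
  Hom x y := Quotient (Term.setoid (S := S) x y)
  id x := ⟦Term.id x⟧
  comp := Quotient.map₂ Term.comp fun _ _ h _ _ h' => Term.Rel.comp_congr h h'
  id_comp f := by
    induction f using Quotient.inductionOn; exact Quotient.sound (Term.Rel.id_comp _)
  comp_id f := by
    induction f using Quotient.inductionOn; exact Quotient.sound (Term.Rel.comp_id _)
  assoc f g h := by
    induction f using Quotient.inductionOn
    induction g using Quotient.inductionOn
    induction h using Quotient.inductionOn
    exact Quotient.sound (Term.Rel.assoc _ _ _)

/-- The morphism represented by a formal string diagram. -/
def mk {x y : List S.Ob} (f : Term S x y) : word x ⟶ word y := Quotient.mk _ f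

theorem mk_eq {x y : List S.Ob} {f g : Term S x y} (h : Term.Rel f g) : mk f = mk g :=
  Quotient.sound h

theorem mk_surj {x y : FreeHyp S} (f : x ⟶ y) : ∃ t : Term S x y, f = mk t :=
  Quotient.inductionOn f fun t => ⟨t, rfl⟩

theorem mk_id (x : List S.Ob) : mk (Term.id x) = 𝟙 (word x) := rfl

theorem mk_comp {x y z : List S.Ob} (f : Term S x y) (g : Term S y z) :
    mk (f.comp g) = mk f ≫ mk g := rfl

theorem mk_ofEq {x y : List S.Ob} (h : x = y) :
    mk (Term.ofEq h) = eqToHom (congrArg word h) := by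
  cases h; rfl

/-- Parallel composition of morphisms. -/
def tens {x y x' y' : List S.Ob} (f : word x ⟶ word y) (g : word x' ⟶ word y') :
    word (x ++ x') ⟶ word (y ++ y') :=
  Quotient.map₂ Term.tensor (fun _ _ h _ _ h' => Term.Rel.tensor_congr h h') f g

theorem mk_tensor {x y x' y' : List S.Ob} (f : Term S x y) (g : Term S x' y') :
    mk (f.tensor g) = tens (mk f) (mk g) := rfl

theorem tens_id (x y : List S.Ob) : tens (𝟙 (word x)) (𝟙 (word y)) = 𝟙 (word (x ++ y)) :=
  mk_eq (Term.Rel.tensor_id x y)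

theorem tens_comp {x y z x' y' z' : List S.Ob} (f : word x ⟶ word y) (g : word y ⟶ word z)
    (f' : word x' ⟶ word y') (g' : word y' ⟶ word z') :
    tens (f ≫ g) (f' ≫ g') = tens f f' ≫ tens g g' := by
  obtain ⟨f, rfl⟩ := mk_surj f
  obtain ⟨g, rfl⟩ := mk_surj g
  obtain ⟨f', rfl⟩ := mk_surj f'
  obtain ⟨g', rfl⟩ := mk_surj g'
  exact mk_eq (Term.Rel.tensor_comp f g f' g')

theorem tens_eqToHom {x y x' y' : List S.Ob} (h : x = y) (h' : x' = y') :
    tens (eqToHom (congrArg word h)) (eqToHom (congrArg word h')) =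
      eqToHom (congrArg word (congrArg₂ (· ++ ·) h h')) := by
  cases h; cases h'; exact tens_id _ _

theorem tens_assoc {x y x' y' x'' y'' : List S.Ob} (f : word x ⟶ word y)
    (g : word x' ⟶ word y') (h : word x'' ⟶ word y'') :
    tens (tens f g) h ≫ eqToHom (congrArg word (List.append_assoc y y' y'')) =
      eqToHom (congrArg word (List.append_assoc x x' x'')) ≫ tens f (tens g h) := by
  obtain ⟨f, rfl⟩ := mk_surj f
  obtain ⟨g, rfl⟩ := mk_surj g
  obtain ⟨h, rfl⟩ := mk_surj h
  rw [← mk_ofEq (List.append_assoc y y' y''), ← mk_ofEq (List.append_assoc x x' x'')]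
  exact mk_eq (Term.Rel.tensor_assoc f g h)

theorem nil_tens {x y : List S.Ob} (f : word x ⟶ word y) :
    tens (𝟙 (word [])) f = f := by
  obtain ⟨f, rfl⟩ := mk_surj f
  exact mk_eq (Term.Rel.nil_tensor f)

theorem tens_nil {x y : List S.Ob} (f : word x ⟶ word y) :
    tens f (𝟙 (word [])) ≫ eqToHom (congrArg word (List.append_nil y)) =
      eqToHom (congrArg word (List.append_nil x)) ≫ f := by
  obtain ⟨f, rfl⟩ := mk_surj f
  rw [← mk_ofEq (List.append_nil y), ← mk_ofEq (List.append_nil x)]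
  exact mk_eq (Term.Rel.tensor_nil f)

theorem eqToHom_coherence {C : Type u₁} [Category.{v₁} C] {a b c d e : C} (h₁ : a = b)
    (h₂ : b = c) (h₃ : c = d) (h₄ : a = e) (h₅ : e = d) :
    eqToHom h₁ ≫ eqToHom h₂ ≫ eqToHom h₃ = eqToHom h₄ ≫ eqToHom h₅ := by
  simp

instance : MonoidalCategoryStruct (FreeHyp S) where
  tensorObj x y := word (List.append x y)
  whiskerLeft x _ _ f := tens (𝟙 (word x)) f
  whiskerRight f y := tens f (𝟙 (word y))
  tensorHom f g := tens f g
  tensorUnit := word []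
  associator x y z := eqToIso (congrArg word (List.append_assoc (α := S.Ob) x y z))
  leftUnitor _ := eqToIso rfl
  rightUnitor x := eqToIso (congrArg word (List.append_nil (α := S.Ob) x))

instance : MonoidalCategory (FreeHyp S) :=
  MonoidalCategory.ofTensorHom
    (id_tensorHom_id := fun x y => tens_id x y)
    (id_tensorHom := fun _ _ _ _ => rfl)
    (tensorHom_id := fun _ _ => rfl)
    (tensorHom_comp_tensorHom := fun f g f' g' => (tens_comp f f' g g').symm)
    (associator_naturality := fun f g h => tens_assoc f g h)
    (leftUnitor_naturality := fun f => by
      refine (Category.comp_id _).trans ((nil_tens f).trans (Category.id_comp _).symm))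
    (rightUnitor_naturality := fun f => tens_nil f)
    (pentagon := fun w x y z => by
      have h₁ := tens_eqToHom (S := S) (List.append_assoc (α := S.Ob) w x y) (rfl : z = z)
      have h₂ := tens_eqToHom (S := S) (rfl : w = w) (List.append_assoc (α := S.Ob) x y z)
      refine (congrArg₂ (fun a b => a ≫ (α_ w (x ⊗ y) z).hom ≫ b) h₁ h₂).trans ?_
      exact eqToHom_coherence _ (congrArg word (List.append_assoc (α := S.Ob) w (List.append x y) z)) _
        (congrArg word (List.append_assoc (α := S.Ob) (List.append w x) y z))
        (congrArg word (List.append_assoc (α := S.Ob) w x (List.append y z))))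
    (triangle := fun x y => by
      have h₁ := tens_eqToHom (S := S) (rfl : x = x) (rfl : y = y)
      have h₂ := tens_eqToHom (S := S) (List.append_nil (α := S.Ob) x) (rfl : y = y)
      refine (congrArg (fun b => (α_ x (𝟙_ (FreeHyp S)) y).hom ≫ b) h₁).trans ?_
      refine Eq.trans ?_ h₂.symm
      exact eqToHom_trans (congrArg word (List.append_assoc (α := S.Ob) x [] y)) _)

instance : StrictMonoidal (FreeHyp S) where
  tensor_assoc x y z := congrArg word (List.append_assoc (α := S.Ob) x y z)
  unit_tensor _ := rfl
  tensor_unit x := congrArg word (List.append_nil (α := S.Ob) x)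
  associator_hom _ _ _ := rfl
  leftUnitor_hom _ := rfl
  rightUnitor_hom _ := rfl

theorem hexagon (x y z : List S.Ob) :
    mk (Term.swap x (y ++ z)) =
      eqToHom (congrArg word (List.append_assoc x y z).symm) ≫
        tens (mk (Term.swap x y)) (𝟙 (word z)) ≫
          eqToHom (congrArg word (List.append_assoc y x z)) ≫
            tens (𝟙 (word y)) (mk (Term.swap x z)) ≫
              eqToHom (congrArg word (List.append_assoc y z x).symm) := by
  refine (mk_eq (Term.Rel.swap_append x y z)).trans ?_
  simp only [mk_comp, mk_tensor, mk_ofEq, mk_id]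

theorem swap_natural {x y x' y' : List S.Ob} (f : word x ⟶ word y) (g : word x' ⟶ word y') :
    tens f g ≫ mk (Term.swap y y') = mk (Term.swap x x') ≫ tens g f := by
  obtain ⟨f, rfl⟩ := mk_surj f
  obtain ⟨g, rfl⟩ := mk_surj g
  exact mk_eq (Term.Rel.swap_natural f g)

/-- The symmetry. -/
def braid (x y : FreeHyp S) : x ⊗ y ≅ y ⊗ x where
  hom := mk (Term.swap x y)
  inv := mk (Term.swap y x)
  hom_inv_id := mk_eq (Term.Rel.swap_swap x y)
  inv_hom_id := mk_eq (Term.Rel.swap_swap y x)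

theorem braid_hexagon (x y z : FreeHyp S) :
    (α_ x y z).hom ≫ (braid x (y ⊗ z)).hom ≫ (α_ y z x).hom =
      ((braid x y).hom ▷ z) ≫ (α_ y x z).hom ≫ (y ◁ (braid x z).hom) := by
  have h : (braid x (y ⊗ z)).hom = (α_ x y z).inv ≫ ((braid x y).hom ▷ z) ≫
      (α_ y x z).hom ≫ (y ◁ (braid x z).hom) ≫ (α_ y z x).inv := hexagon x y z
  rw [h]
  simp

instance : BraidedCategory (FreeHyp S) where
  braiding := braid
  braiding_naturality_right x _ _ f := swap_natural (𝟙 (word x)) f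
  braiding_naturality_left f z := swap_natural f (𝟙 (word z))
  hexagon_forward := braid_hexagon
  hexagon_reverse x y z := by
    have h : α_ z x y ≪≫ braid z (x ⊗ y) ≪≫ α_ x y z =
        whiskerRightIso (braid z x) y ≪≫ α_ x z y ≪≫ whiskerLeftIso x (braid z y) :=
      Iso.ext (braid_hexagon z x y)
    have h' := congrArg Iso.inv h
    simp only [Iso.trans_inv, Category.assoc] at h'
    exact h'

instance : SymmetricCategory (FreeHyp S) where
  symmetry x y := mk_eq (Term.Rel.swap_swap x y)

theorem mk_middle (x y z w : List S.Ob) :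
    mk (Term.middle x y z w) =
      eqToHom (congrArg word (List.append_assoc x y (z ++ w))) ≫
        tens (𝟙 (word x)) (eqToHom (congrArg word (List.append_assoc y z w).symm)) ≫
          tens (𝟙 (word x)) (tens (mk (Term.swap y z)) (𝟙 (word w))) ≫
            tens (𝟙 (word x)) (eqToHom (congrArg word (List.append_assoc z y w))) ≫
              eqToHom (congrArg word (List.append_assoc x z (y ++ w)).symm) := by
  have h₁ := tens_eqToHom (rfl : x = x) (List.append_assoc y z w).symm
  have h₂ := tens_eqToHom (rfl : x = x) (List.append_assoc z y w)
  rw [eqToHom_refl] at h₁ h₂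
  rw [h₁, h₂, Term.middle, mk_comp, mk_comp, mk_ofEq, mk_ofEq, mk_tensor, mk_tensor, mk_id, mk_id]
  have h₄ : tens (tens (𝟙 (word x)) (mk (Term.swap y z))) (𝟙 (word w)) =
      eqToHom (congrArg word (List.append_assoc x (y ++ z) w)) ≫
        tens (𝟙 (word x)) (tens (mk (Term.swap y z)) (𝟙 (word w))) ≫
          eqToHom (congrArg word (List.append_assoc x (z ++ y) w).symm) := by
    rw [← Category.assoc, ← tens_assoc]
    simp
  rw [h₄]
  simp

theorem mk_middle_eq_tensorμ (x y z w : FreeHyp S) :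
    mk (Term.middle (S := S) x y z w) = tensorμ x y z w := mk_middle x y z w

theorem copy_append (x y : List S.Ob) :
    mk (Term.copy (x ++ y)) =
      tens (mk (Term.copy x)) (mk (Term.copy y)) ≫ mk (Term.middle x x y y) :=
  mk_eq (Term.Rel.copy_append x y)

theorem compare_append (x y : List S.Ob) :
    mk (Term.compare (x ++ y)) =
      mk (Term.middle x y x y) ≫ tens (mk (Term.compare x)) (mk (Term.compare y)) :=
  mk_eq (Term.Rel.compare_append x y)

theorem copy_del_right (x : List S.Ob) :
    mk (Term.copy x) ≫ tens (𝟙 (word x)) (mk (Term.del x)) =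
      eqToHom (congrArg word (List.append_nil x).symm) := by
  have h := mk_eq (Term.Rel.copy_del_right (S := S) x)
  simp only [mk_comp, mk_ofEq, mk_tensor, mk_id] at h
  rw [← cancel_mono (eqToHom (congrArg word (List.append_nil x))), h]
  simp

theorem omni_compare_right (x : List S.Ob) :
    tens (𝟙 (word x)) (mk (Term.omni x)) ≫ mk (Term.compare x) =
      eqToHom (congrArg word (List.append_nil x)) := by
  have h := mk_eq (Term.Rel.omni_compare_right (S := S) x)
  simpa only [mk_comp, mk_ofEq, mk_tensor, mk_id] using h

theorem copy_assoc (x : List S.Ob) :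
    mk (Term.copy x) ≫ tens (𝟙 (word x)) (mk (Term.copy x)) =
      mk (Term.copy x) ≫ tens (mk (Term.copy x)) (𝟙 (word x)) ≫
        eqToHom (congrArg word (List.append_assoc x x x)) := by
  have h := mk_eq (Term.Rel.copy_assoc (S := S) x)
  simp only [mk_comp, mk_ofEq, mk_tensor, mk_id, Category.assoc] at h
  exact h.symm

theorem compare_assoc (x : List S.Ob) :
    tens (mk (Term.compare x)) (𝟙 (word x)) ≫ mk (Term.compare x) =
      eqToHom (congrArg word (List.append_assoc x x x)) ≫
        tens (𝟙 (word x)) (mk (Term.compare x)) ≫ mk (Term.compare x) := by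
  have h := mk_eq (Term.Rel.compare_assoc (S := S) x)
  simpa only [mk_comp, mk_ofEq, mk_tensor, mk_id] using h

theorem frobenius_left (x : List S.Ob) :
    tens (mk (Term.copy x)) (𝟙 (word x)) ≫ eqToHom (congrArg word (List.append_assoc x x x)) ≫
        tens (𝟙 (word x)) (mk (Term.compare x)) =
      mk (Term.compare x) ≫ mk (Term.copy x) := by
  have h := mk_eq (Term.Rel.frobenius_left (S := S) x)
  simpa only [mk_comp, mk_ofEq, mk_tensor, mk_id] using h

theorem frobenius_right (x : List S.Ob) :
    tens (𝟙 (word x)) (mk (Term.copy x)) ≫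
        eqToHom (congrArg word (List.append_assoc x x x).symm) ≫
          tens (mk (Term.compare x)) (𝟙 (word x)) =
      mk (Term.compare x) ≫ mk (Term.copy x) := by
  have h := mk_eq (Term.Rel.frobenius_right (S := S) x)
  simpa only [mk_comp, mk_ofEq, mk_tensor, mk_id] using h

instance (x : FreeHyp S) : ComonObj x where
  counit := mk (Term.del x)
  comul := mk (Term.copy x)
  counit_comul := mk_eq (Term.Rel.copy_del_left x)
  comul_counit := copy_del_right x
  comul_assoc := copy_assoc x

instance (x : FreeHyp S) : IsCommComonObj x where
  comul_comm := mk_eq (Term.Rel.copy_comm x)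

instance (x : FreeHyp S) : MonObj x where
  one := mk (Term.omni x)
  mul := mk (Term.compare x)
  one_mul := mk_eq (Term.Rel.omni_compare_left x)
  mul_one := omni_compare_right x
  mul_assoc := compare_assoc x

instance (x : FreeHyp S) : IsCommMonObj x where
  mul_comm := mk_eq (Term.Rel.compare_comm x)

instance : CopyDiscardCategory (FreeHyp S) where
  copy_tensor x y :=
    (copy_append x y).trans (congrArg (_ ≫ ·) (mk_middle_eq_tensorμ x x y y))
  discard_tensor x y := (mk_eq (Term.Rel.del_append x y)).trans (Category.comp_id _).symm
  copy_unit := mk_eq Term.Rel.copy_nil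
  discard_unit := mk_eq Term.Rel.del_nil

instance : HypergraphCategory (FreeHyp S) where
  compare_tensor x y :=
    (compare_append x y).trans (congrArg (· ≫ _) (mk_middle_eq_tensorμ x y x y))
  omni_tensor x y := (mk_eq (Term.Rel.omni_append x y)).trans (Category.id_comp _).symm
  compare_unit := mk_eq Term.Rel.compare_nil
  omni_unit := mk_eq Term.Rel.omni_nil
  special x := mk_eq (Term.Rel.special x)
  frobenius_left x := frobenius_left x
  frobenius_right x := frobenius_right x

/-- A generating morphism, as a morphism of the free hypergraph category. -/
def gen (g : S.Gen) : word (S.dom g) ⟶ word (S.cod g) := mk (Term.gen g)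

variable [LinearOrder S.Ob]

/-- The increasing list of the elements of `s`. -/
def sortedList (s : Finset S.Ob) : List S.Ob := s.sort

/-- The tensor product of the elements of `s`, in increasing order. -/
def sorted (s : Finset S.Ob) : FreeHyp S := word (sortedList s)

/-- Compare a wire labelled `a` with the (first) wire of `w` labelled `a`. (If `a` does not occur
in `w`, the wire is deleted; this case is never used.) -/
def insertWire (a : S.Ob) : (w : List S.Ob) → (word [a] ⊗ word w ⟶ word w)
  | [] => delMap (word [a])
  | b :: w =>
    if h : a = b then
      eqToHom (by subst h; rfl : word [a] ⊗ word (b :: w) = (word [b] ⊗ word [b]) ⊗ word w) ≫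
        (compareMap (word [b]) ▷ word w)
    else
      eqToHom (rfl : word [a] ⊗ word (b :: w) = (word [a] ⊗ word [b]) ⊗ word w) ≫
        ((β_ (word [a]) (word [b])).hom ▷ word w) ≫
          (α_ (word [b]) (word [a]) (word w)).hom ≫ (word [b] ◁ insertWire a w)

/-- For words `u`, `w`, where `w` has distinct letters including all those of `u`: for each letter
of `w`, compare all the wires of `u` labelled by that letter (the comparison of no wires is `omni`,
the comparison of one wire is that wire). -/
def collect : (u w : List S.Ob) → (word u ⟶ word w)
  | [], w => omniMap (word w)
  | a :: u, w => (word [a] ◁ collect u w) ≫ insertWire a w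

variable (S) in
/-- A factor: a morphism from the unit to the tensor product of a set of generating objects. -/
structure Factor where
  out : Finset S.Ob
  hom : 𝟙_ (FreeHyp S) ⟶ sorted out

/-- The outputs of a collection of factors. -/
def outs : List (Factor S) → Finset S.Ob
  | [] => ∅
  | φ :: l => φ.out ∪ outs l

/-- The compare-composition of a finite collection of factors (listed in some order): the
compare-composition of no factors is the identity of the unit, and the compare-composition of `φ`
and the factors in `l` is obtained by putting `φ` beside the compare-composition of `l`, permuting
wires, and comparing the shared outputs. -/
def compComp : (l : List (Factor S)) → (𝟙_ (FreeHyp S) ⟶ sorted (outs l))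
  | [] => eqToHom (by simp [sorted, sortedList, outs]; rfl)
  | φ :: l =>
    (λ_ (𝟙_ (FreeHyp S))).inv ≫ (φ.hom ⊗ₘ compComp l) ≫
      collect (sortedList φ.out ++ sortedList (outs l)) (sortedList (outs (φ :: l)))

end FreeHyp

/-! ### Ordered undirected graphs -/

/-- A finite undirected graph with a total order on its vertices. -/
structure OUGr where
  V : Type u
  [fintype : Fintype V]
  [order : LinearOrder V]
  graph : SimpleGraph V

namespace OUGr

attribute [instance] fintype order

/-- Order-preserving graph homomorphisms. Adjacent vertices may be identified. -/
@[ext]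
structure Hom (H H' : OUGr.{u}) where
  toFun : H.V → H'.V
  monotone : Monotone toFun
  map_adj : ∀ x y, H.graph.Adj x y → toFun x = toFun y ∨ H'.graph.Adj (toFun x) (toFun y)

instance : Category OUGr.{u} where
  Hom := Hom
  id H := ⟨fun x => x, monotone_id, fun _ _ h => Or.inr h⟩
  comp α β := ⟨fun x => β.toFun (α.toFun x), β.monotone.comp α.monotone, fun x y h => by
    rcases α.map_adj x y h with h | h
    · exact Or.inl (congrArg _ h)
    · exact β.map_adj _ _ h⟩

/-- The (nonempty) cliques of a graph. -/
def Clique (H : OUGr.{u}) : Type u :=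
  {C : Finset H.V // C.Nonempty ∧ H.graph.IsClique (C : Set H.V)}

/-- The signature of an ordered undirected graph: the generating objects are the vertices, and
there is one generating morphism from the unit to `C` for every clique `C`. -/
def sig (H : OUGr.{u}) : MonSig.{u} where
  Ob := H.V
  Gen := H.Clique
  dom _ := []
  cod C := C.1.sort

instance (H : OUGr.{u}) : LinearOrder H.sig.Ob := H.order

/-- The free hypergraph category on the signature of a graph. -/
def syn (H : OUGr.{u}) : HypCat.{u, u} := ⟨FreeHyp H.sig⟩

/-- The factor given by the generating morphism of a clique. -/
def cliqueFactor (H : OUGr.{u}) (C : H.Clique) : FreeHyp.Factor H.sig :=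
  ⟨C.1, FreeHyp.gen (S := H.sig) C⟩

/-- The set of vertices mapped into `C`. -/
def preimage {H H' : OUGr.{u}} (α : H ⟶ H') (C : Finset H'.V) : Finset H.V :=
  Finset.univ.filter fun x => α.toFun x ∈ C

/-- The set of vertices that are images of elements of `D`. -/
def image {H H' : OUGr.{u}} (α : H ⟶ H') (D : Finset H.V) : Finset H'.V :=
  D.image α.toFun

end OUGr

/-! A hypergraph functor out of a free hypergraph category is determined by its values on objects
and on generators (`hypFunctor_ext`), and every interpretation of the signature extends to one
(`lift`). So the prescribed values define $\mathsf{Syn}_\alpha$; the real content is that they are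
compatible with identities and composition.

The key is to turn compare-composition into a product. The morphisms $I\to W$ form a commutative
monoid `Point W`: two of them are multiplied by putting them side by side and comparing, and omni is
the unit. Once all factors are extended by omni to a common word containing their outputs, comparing
shared outputs is multiplication in this monoid (`compComp_comp_collect`). Thus
$\mathsf{Syn}_\alpha(\phi_C)=\prod_{\alpha(D)=C}\phi_D$ among the points of $\alpha^{-1}(C)$.

The wiring is controlled by one observation: for morphisms preserving compare and omni, $X\otimes Y$
behaves as a coproduct, with injections `inl`, `inr` and copairing `merge`. The map `collect` is an
iterated copairing of single wires. Hence it preserves compare and omni, such maps compose as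
expected (`collect_comp_collect`), and a functor sending letters to disjoint words without
repetitions sends `collect` to `collect` (`SeparatesLetters.map_collect`). Extension by omni and
$\mathsf{Syn}_\alpha$ itself therefore act on points by monoid homomorphisms, and they commute.

Functoriality is then a regrouping of a finite product (`mapPoint_cliquePoint`):
$\mathsf{Syn}_\alpha(\mathsf{Syn}_\beta(\phi_C))=\prod_{\beta(D)=C}\prod_{\alpha(E)=D}\phi_E=\prod_{\beta(\alpha(E))=C}\phi_E$.
The edge condition on $\alpha$ ensures that each $\alpha(E)$ is a clique, so that no $E$ is lost;
monotonicity ensures that concatenated sorted fibres are sorted, so that the objects agree on the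
nose. -/

namespace StrictMonoidal

/-! ### Coherence in strict monoidal categories -/

section tensor
variable {C : Type u} [Category.{v} C] [MonoidalCategory C]

theorem eqToHom_comp_tensorHom {X X' Y Z W : C} (h : X = X') (f : X' ⟶ Y) (g : Z ⟶ W) :
    (eqToHom h ≫ f) ⊗ₘ g = eqToHom (by rw [h]) ≫ (f ⊗ₘ g) := by
  subst h; simp

theorem comp_eqToHom_tensorHom {X Y Y' Z W : C} (h : Y = Y') (f : X ⟶ Y) (g : Z ⟶ W) :
    (f ≫ eqToHom h) ⊗ₘ g = (f ⊗ₘ g) ≫ eqToHom (by rw [h]) := by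
  subst h; simp

theorem tensorHom_eqToHom_comp {X Y Z Z' W : C} (h : Z = Z') (f : X ⟶ Y) (g : Z' ⟶ W) :
    f ⊗ₘ (eqToHom h ≫ g) = eqToHom (by rw [h]) ≫ (f ⊗ₘ g) := by
  subst h; simp

theorem tensorHom_comp_eqToHom {X Y Z W W' : C} (h : W = W') (f : X ⟶ Y) (g : Z ⟶ W) :
    f ⊗ₘ (g ≫ eqToHom h) = (f ⊗ₘ g) ≫ eqToHom (by rw [h]) := by
  subst h; simp

theorem braiding_congr [BraidedCategory C] {X X' Y Y' : C} (h : X = X') (h' : Y = Y') :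
    (β_ X Y).hom = eqToHom (by rw [h, h']) ≫ (β_ X' Y').hom ≫ eqToHom (by rw [h, h']) := by
  subst h h'; simp

end tensor

section strict
variable {C : Type u} [Category.{v} C] [MonoidalCategory C] [StrictMonoidal C]

theorem associator_inv (X Y Z : C) : (α_ X Y Z).inv = eqToHom (tensor_assoc X Y Z).symm := by
  rw [← cancel_epi (α_ X Y Z).hom, Iso.hom_inv_id, associator_hom]; simp

theorem leftUnitor_inv (X : C) : (λ_ X).inv = eqToHom (unit_tensor X).symm := by
  rw [← cancel_epi (λ_ X).hom, Iso.hom_inv_id, leftUnitor_hom]; simp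

theorem rightUnitor_inv (X : C) : (ρ_ X).inv = eqToHom (tensor_unit X).symm := by
  rw [← cancel_epi (ρ_ X).hom, Iso.hom_inv_id, rightUnitor_hom]; simp

theorem tensorHom_assoc {X Y X' Y' X'' Y'' : C} (f : X ⟶ Y) (g : X' ⟶ Y') (h : X'' ⟶ Y'') :
    (f ⊗ₘ g) ⊗ₘ h =
      eqToHom (tensor_assoc _ _ _) ≫ (f ⊗ₘ (g ⊗ₘ h)) ≫ eqToHom (tensor_assoc _ _ _).symm := by
  rw [← associator_hom, ← associator_inv]; simp

theorem unit_tensorHom {U X Y : C} (hU : U = 𝟙_ C) (f : X ⟶ Y) :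
    𝟙 U ⊗ₘ f =
      eqToHom (by rw [hU, unit_tensor]) ≫ f ≫ eqToHom (by rw [hU, unit_tensor]) := by
  subst hU
  have := leftUnitor_naturality f
  rw [leftUnitor_hom, leftUnitor_hom] at this
  rw [id_tensorHom, ← Category.assoc, ← this]
  simp

theorem tensorHom_unit {U X Y : C} (hU : U = 𝟙_ C) (f : X ⟶ Y) :
    f ⊗ₘ 𝟙 U =
      eqToHom (by rw [hU, tensor_unit]) ≫ f ≫ eqToHom (by rw [hU, tensor_unit]) := by
  subst hU
  have := rightUnitor_naturality f
  rw [rightUnitor_hom, rightUnitor_hom] at this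
  rw [tensorHom_id, ← Category.assoc, ← this]
  simp

/-- With strict associators the interchange is a single braiding between identities, which is the
shape of `Term.middle`. -/
theorem tensorμ_eq [BraidedCategory C] (X Y Z W : C) :
    tensorμ X Y Z W = eqToHom (by simp only [tensor_assoc]) ≫
      ((𝟙 X ⊗ₘ (β_ Y Z).hom) ⊗ₘ 𝟙 W) ≫ eqToHom (by simp only [tensor_assoc]) := by
  rw [tensorHom_assoc]
  simp [tensorμ, associator_inv, associator_hom]

end strict

section hypergraph
variable {C : Type u} [Category.{v} C] [MonoidalCategory C] [HypergraphCategory C]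

theorem copyMap_congr {X Y : C} (h : X = Y) :
    copyMap X = eqToHom h ≫ copyMap Y ≫ eqToHom (by rw [h]) := by
  subst h; simp

theorem delMap_congr {X Y : C} (h : X = Y) : delMap X = eqToHom h ≫ delMap Y := by
  subst h; simp

theorem compareMap_congr {X Y : C} (h : X = Y) :
    compareMap X = eqToHom (by rw [h]) ≫ compareMap Y ≫ eqToHom h.symm := by
  subst h; simp

theorem omniMap_congr {X Y : C} (h : X = Y) : omniMap X = omniMap Y ≫ eqToHom h.symm := by
  subst h; simp

end hypergraph

end StrictMonoidal

/-! ### The universal property of the free hypergraph category -/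

/-- An interpretation of a signature in a strict hypergraph category. -/
structure MonSig.Interp (S : MonSig.{u}) (D : Type u₁) [Category.{v₁} D] [MonoidalCategory D]
    [HypergraphCategory D] where
  obj : List S.Ob → D
  obj_nil : obj [] = 𝟙_ D
  obj_append : ∀ x y, obj (x ++ y) = obj x ⊗ obj y
  gen : ∀ g : S.Gen, obj (S.dom g) ⟶ obj (S.cod g)

namespace Term

open StrictMonoidal

variable {S : MonSig.{u}} {D : Type u₁} [Category.{v₁} D] [MonoidalCategory D]
  [HypergraphCategory D]

/-- The value of a formal string diagram. -/
def eval (I : S.Interp D) : {x y : List S.Ob} → Term S x y → (I.obj x ⟶ I.obj y)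
  | _, _, id x => 𝟙 (I.obj x)
  | _, _, comp f g => eval I f ≫ eval I g
  | _, _, tensor f g =>
    eqToHom (I.obj_append _ _) ≫ (eval I f ⊗ₘ eval I g) ≫ eqToHom (I.obj_append _ _).symm
  | _, _, swap x y =>
    eqToHom (I.obj_append x y) ≫ (β_ (I.obj x) (I.obj y)).hom ≫ eqToHom (I.obj_append y x).symm
  | _, _, copy x => copyMap (I.obj x) ≫ eqToHom (I.obj_append x x).symm
  | _, _, del x => delMap (I.obj x) ≫ eqToHom I.obj_nil.symm
  | _, _, compare x => eqToHom (I.obj_append x x) ≫ compareMap (I.obj x)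
  | _, _, omni x => eqToHom I.obj_nil ≫ omniMap (I.obj x)
  | _, _, gen g => I.gen g

theorem eval_ofEq (I : S.Interp D) {x y : List S.Ob} (h : x = y) :
    eval I (ofEq h) = eqToHom (congrArg I.obj h) := by
  subst h; rfl

variable [StrictMonoidal D]

theorem eval_middle (I : S.Interp D) (x y z w : List S.Ob) :
    eval I (middle x y z w) = eqToHom (by simp only [I.obj_append]) ≫
      tensorμ (I.obj x) (I.obj y) (I.obj z) (I.obj w) ≫
        eqToHom (by simp only [I.obj_append]) := by
  simp [middle, eval, eval_ofEq, tensorμ_eq, tensorHom_eqToHom_comp, tensorHom_comp_eqToHom,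
    eqToHom_comp_tensorHom, comp_eqToHom_tensorHom, -tensorHom_id, -id_tensorHom]

/-- Soundness: each clause of `Rel` is a law of strict hypergraph categories. The work lies in
moving the `eqToHom`s out of tensor products until the clause becomes the law. -/
theorem eval_congr (I : S.Interp D) {x y : List S.Ob} {f g : Term S x y} (h : Rel f g) :
    eval I f = eval I g := by
  induction h with
  | refl f => rfl
  | symm _ ih => exact ih.symm
  | trans _ _ ih ih' => exact ih.trans ih'
  | comp_congr _ _ ih ih' => simp only [eval, ih, ih']
  | tensor_congr _ _ ih ih' => simp only [eval, ih, ih']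
  | id_comp f => simp [eval]
  | comp_id f => simp [eval]
  | assoc f g h => simp [eval]
  | tensor_id x y => simp [eval]
  | tensor_comp f g f' g' => simp [eval]
  | tensor_assoc f g h =>
    simp [eval, eval_ofEq, tensorHom_eqToHom_comp, tensorHom_comp_eqToHom,
      eqToHom_comp_tensorHom, comp_eqToHom_tensorHom, StrictMonoidal.associator_hom,
      StrictMonoidal.associator_inv]
  | nil_tensor f =>
    simp [eval, unit_tensorHom I.obj_nil, -tensorHom_id, -id_tensorHom]
  | tensor_nil f =>
    simp [eval, eval_ofEq, tensorHom_unit I.obj_nil, -tensorHom_id, -id_tensorHom]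
  | swap_natural f g => simp [eval]
  | swap_swap x y => simp [eval]
  | swap_append x y z =>
    simp [eval, eval_ofEq, braiding_congr rfl (I.obj_append _ _),
      StrictMonoidal.associator_hom, StrictMonoidal.associator_inv]
  | copy_del_left x =>
    have := ComonObj.counit_comul (I.obj x)
    rw [leftUnitor_inv] at this
    simp [eval, reassoc_of% this]
  | copy_del_right x =>
    have := ComonObj.comul_counit (I.obj x)
    rw [rightUnitor_inv] at this
    simp [eval, eval_ofEq, reassoc_of% this]
  | copy_assoc x =>
    have := ComonObj.comul_assoc (I.obj x)
    rw [StrictMonoidal.associator_hom] at this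
    simp [eval, eval_ofEq, reassoc_of% this]
  | copy_comm x => simp [eval]
  | copy_append x y =>
    simp [eval, eval_middle, copyMap_congr (I.obj_append _ _), CopyDiscardCategory.copy_tensor,
      tensorHom_comp_eqToHom, comp_eqToHom_tensorHom]
  | copy_nil =>
    simp [eval, copyMap_congr I.obj_nil, CopyDiscardCategory.copy_unit, leftUnitor_inv]
  | del_append x y =>
    simp [eval, delMap_congr (I.obj_append _ _), CopyDiscardCategory.discard_tensor,
      leftUnitor_hom, tensorHom_comp_eqToHom, comp_eqToHom_tensorHom]
  | del_nil => simp [eval, delMap_congr I.obj_nil, CopyDiscardCategory.discard_unit]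
  | omni_compare_left x =>
    have := MonObj.one_mul (I.obj x)
    rw [leftUnitor_hom] at this
    simp [eval, this]
  | omni_compare_right x =>
    have := MonObj.mul_one (I.obj x)
    rw [rightUnitor_hom] at this
    simp [eval, eval_ofEq, this]
  | compare_assoc x =>
    have := MonObj.mul_assoc (I.obj x)
    rw [StrictMonoidal.associator_hom] at this
    simp [eval, eval_ofEq, this]
  | compare_comm x => simp [eval]
  | compare_append x y =>
    simp [eval, eval_middle, compareMap_congr (I.obj_append _ _),
      HypergraphCategory.compare_tensor, tensorHom_eqToHom_comp, eqToHom_comp_tensorHom]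
  | compare_nil =>
    simp [eval, compareMap_congr I.obj_nil, HypergraphCategory.compare_unit, leftUnitor_hom]
  | omni_append x y =>
    simp [eval, omniMap_congr (I.obj_append _ _), HypergraphCategory.omni_tensor,
      leftUnitor_inv, tensorHom_eqToHom_comp, eqToHom_comp_tensorHom]
  | omni_nil => simp [eval, omniMap_congr I.obj_nil, HypergraphCategory.omni_unit]
  | special x => simp [eval, HypergraphCategory.special]
  | frobenius_left x =>
    have := HypergraphCategory.frobenius_left (I.obj x)
    rw [StrictMonoidal.associator_hom] at this
    simp [eval, eval_ofEq, ← reassoc_of% this]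
  | frobenius_right x =>
    have := HypergraphCategory.frobenius_right (I.obj x)
    rw [StrictMonoidal.associator_inv] at this
    simp [eval, eval_ofEq, ← reassoc_of% this]

end Term

namespace FreeHyp

variable {S : MonSig.{u}} {D : Type u₁} [Category.{v₁} D] [MonoidalCategory D]
  [HypergraphCategory D]

/-- The hypergraph functor out of the free hypergraph category extending an interpretation. -/
def lift [StrictMonoidal D] (I : S.Interp D) : HypFunctor (FreeHyp S) D where
  obj := I.obj
  map {x y} := Quotient.lift (fun t : Term S x y => t.eval I) fun _ _ h => Term.eval_congr I h
  map_id _ := rfl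
  map_comp f g := by
    obtain ⟨f, rfl⟩ := mk_surj f
    obtain ⟨g, rfl⟩ := mk_surj g
    rfl
  obj_unit := I.obj_nil
  obj_tensor := I.obj_append
  map_tensor f g := by
    obtain ⟨f, rfl⟩ := mk_surj f
    obtain ⟨g, rfl⟩ := mk_surj g
    rfl
  map_braiding _ _ := rfl
  map_copy _ := rfl
  map_del _ := rfl
  map_compare _ := rfl
  map_omni _ := rfl

/-- Hypergraph functors out of the free hypergraph category that agree on objects and on the
generating morphisms are equal. -/
theorem hypFunctor_ext {F G : HypFunctor (FreeHyp S) D} (hobj : F.obj = G.obj)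
    (hgen : ∀ g : S.Gen, F.map (gen g) =
      eqToHom (congrFun hobj _) ≫ G.map (gen g) ≫ eqToHom (congrFun hobj _).symm) : F = G := by
  obtain ⟨⟨o, m, mi, mc⟩, F1, F2, F3, F4, F5, F6, F7, F8⟩ := F
  obtain ⟨⟨o', m', mi', mc'⟩, G1, G2, G3, G4, G5, G6, G7, G8⟩ := G
  obtain rfl : o = o' := hobj
  simp only [eqToHom_refl, Category.comp_id, Category.id_comp] at hgen
  -- By induction on the diagram: the functor axioms fix the value of every constructor except
  -- `gen`, where `hgen` applies.
  have key : ∀ {x y : List S.Ob} (t : Term S x y), m (mk t) = m' (mk t) := by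
    intro x y t
    induction t with
    | id x => exact (mi _).trans (mi' _).symm
    | comp f g hf hg =>
      exact (mc _ _).trans ((congrArg₂ (· ≫ ·) hf hg).trans (mc' _ _).symm)
    | tensor f g hf hg =>
      refine (F3 (mk f) (mk g)).trans (Eq.trans ?_ (G3 (mk f) (mk g)).symm)
      exact congrArg₂ (fun a b => eqToHom _ ≫ (a ⊗ₘ b) ≫ eqToHom _) hf hg
    | swap x y => exact (F4 _ _).trans (G4 _ _).symm
    | copy x => exact (F5 _).trans (G5 _).symm
    | del x => exact (F6 _).trans (G6 _).symm
    | compare x => exact (F7 _).trans (G7 _).symm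
    | omni x => exact (F8 _).trans (G8 _).symm
    | gen g => exact hgen g
  have hm : @m = @m' := by
    funext x y f
    obtain ⟨t, rfl⟩ := mk_surj f
    exact key t
  subst hm
  rfl

end FreeHyp

theorem eqToHom_tensorHom_eqToHom_comp {C : Type u} [Category.{v} C] [MonoidalCategory C]
    {X X' Y Y' Z : C} (h : X = X') (h' : Y = Y') (f : X' ⊗ Y' ⟶ Z) :
    (eqToHom h ⊗ₘ eqToHom h') ≫ f = eqToHom (by rw [h, h']) ≫ f := by
  subst h h'; simp

/-! ### Tensor products as coproducts for maps preserving compare and omni -/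

section merge

variable {C : Type u} [Category.{v} C] [MonoidalCategory C] [HypergraphCategory C]

/-- A morphism that preserves the monoids given by compare and omni. -/
structure IsCompareHom {X Y : C} (f : X ⟶ Y) : Prop where
  omni : omniMap X ≫ f = omniMap Y
  compare : compareMap X ≫ f = (f ⊗ₘ f) ≫ compareMap Y

/-- Put two morphisms beside each other and compare their outputs. -/
def merge {X Y W : C} (f : X ⟶ W) (g : Y ⟶ W) : X ⊗ Y ⟶ W := (f ⊗ₘ g) ≫ compareMap W

/-- Put omni to the right of a wire. -/
def inl (X Y : C) : X ⟶ X ⊗ Y := (ρ_ X).inv ≫ X ◁ omniMap Y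

/-- Put omni to the left of a wire. -/
def inr (X Y : C) : Y ⟶ X ⊗ Y := (λ_ Y).inv ≫ omniMap X ▷ Y

variable {X X' Y Y' Z W : C}

theorem merge_comp {h : W ⟶ Z} (hh : IsCompareHom h) (f : X ⟶ W) (g : Y ⟶ W) :
    merge f g ≫ h = merge (f ≫ h) (g ≫ h) := by
  simp [merge, hh.compare]

theorem comp_merge (p : X' ⟶ X) (q : Y' ⟶ Y) (f : X ⟶ W) (g : Y ⟶ W) :
    (p ⊗ₘ q) ≫ merge f g = merge (p ≫ f) (q ≫ g) := by
  simp [merge]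

theorem merge_id_id (X : C) : merge (𝟙 X) (𝟙 X) = compareMap X := by
  simp [merge]

theorem whiskerLeft_merge (q : Y' ⟶ Y) (f : X ⟶ W) (g : Y ⟶ W) :
    X ◁ q ≫ merge f g = merge f (q ≫ g) := by
  rw [← id_tensorHom, comp_merge, Category.id_comp]

theorem whiskerRight_merge (p : X' ⟶ X) (f : X ⟶ W) (g : Y ⟶ W) :
    p ▷ Y ≫ merge f g = merge (p ≫ f) g := by
  rw [← tensorHom_id, comp_merge, Category.id_comp]

theorem merge_assoc (f : X ⟶ W) (g : Y ⟶ W) (h : Z ⟶ W) :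
    merge (merge f g) h = (α_ X Y Z).hom ≫ merge f (merge g h) := by
  have h₁ : merge (merge f g) h = ((f ⊗ₘ g) ⊗ₘ h) ≫ compareMap W ▷ W ≫ compareMap W := by
    rw [merge, merge, ← tensorHom_id, tensorHom_comp_tensorHom_assoc, Category.comp_id]
  have h₂ : merge f (merge g h) = (f ⊗ₘ (g ⊗ₘ h)) ≫ W ◁ compareMap W ≫ compareMap W := by
    rw [merge, merge, ← id_tensorHom, tensorHom_comp_tensorHom_assoc, Category.comp_id]
  rw [h₁, h₂, MonObj.mul_assoc]
  simp

theorem merge_omni_right (f : X ⟶ W) : merge f (omniMap W) = (ρ_ X).hom ≫ f :=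
  MonObj.mul_one_hom f

theorem merge_omni_left (g : Y ⟶ W) : merge (omniMap W) g = (λ_ Y).hom ≫ g :=
  MonObj.one_mul_hom g

theorem merge_comm (f : X ⟶ W) (g : Y ⟶ W) : merge f g = (β_ X Y).hom ≫ merge g f := by
  have h : (f ⊗ₘ g) ≫ (β_ W W).hom ≫ compareMap W = (f ⊗ₘ g) ≫ compareMap W := by
    rw [IsCommMonObj.mul_comm]
  rw [merge, ← h, BraidedCategory.braiding_naturality_assoc, merge]

/-- Compare on a tensor product is the interchange followed by compare in each component, so merging
can be done componentwise. -/
theorem tensorμ_merge (f₁ : X ⟶ W) (f₂ : X' ⟶ W) (g₁ : Y ⟶ Z) (g₂ : Y' ⟶ Z) :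
    tensorμ X Y X' Y' ≫ (merge f₁ f₂ ⊗ₘ merge g₁ g₂) = merge (f₁ ⊗ₘ g₁) (f₂ ⊗ₘ g₂) := by
  rw [merge, merge, merge, show compareMap (W ⊗ Z) = _ from HypergraphCategory.compare_tensor W Z,
    tensorμ_natural_assoc, tensorHom_comp_tensorHom]

theorem omniMap_tensor_merge (f : X ⟶ W) (g : Y ⟶ W) :
    omniMap (X ⊗ Y) ≫ merge f g =
      (λ_ (𝟙_ C)).inv ≫ merge (omniMap X ≫ f) (omniMap Y ≫ g) := by
  rw [omniMap, HypergraphCategory.omni_tensor, Category.assoc, comp_merge]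

namespace IsCompareHom

theorem comp {f : X ⟶ Y} {g : Y ⟶ Z} (hf : IsCompareHom f) (hg : IsCompareHom g) :
    IsCompareHom (f ≫ g) :=
  ⟨by rw [← Category.assoc, hf.omni, hg.omni],
    by rw [← Category.assoc, hf.compare, Category.assoc, hg.compare, tensorHom_comp_tensorHom_assoc]⟩

theorem omniMap (X : C) : IsCompareHom (omniMap X) where
  omni := by rw [_root_.omniMap, HypergraphCategory.omni_unit, Category.id_comp]
  compare := by
    rw [compareMap, HypergraphCategory.compare_unit]
    exact (merge_omni_left _).symm

/-- As for commutative monoids, the product of two homomorphisms is a homomorphism because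
$(ab)(cd)=(ac)(bd)$. -/
theorem merge {f : X ⟶ W} {g : Y ⟶ W} (hf : IsCompareHom f) (hg : IsCompareHom g) :
    IsCompareHom (merge f g) where
  omni := by
    rw [omniMap_tensor_merge, hf.omni, hg.omni, merge_omni_left, Iso.inv_hom_id_assoc]
  compare := by
    have h := MonObj.mul_mul_mul_comm (M := W)
    rw [compareMap, HypergraphCategory.compare_tensor, Category.assoc, comp_merge, hf.compare,
      hg.compare]
    have h₁ : _root_.merge ((f ⊗ₘ f) ≫ compareMap W) ((g ⊗ₘ g) ≫ compareMap W) =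
        ((f ⊗ₘ f) ⊗ₘ (g ⊗ₘ g)) ≫ (compareMap W ⊗ₘ compareMap W) ≫ compareMap W := by
      rw [_root_.merge, tensorHom_comp_tensorHom_assoc]
    rw [h₁, ← tensorμ_natural_assoc, h, _root_.merge, ← tensorHom_comp_tensorHom, Category.assoc]

theorem inl (X Y : C) : IsCompareHom (inl X Y) where
  omni := by
    rw [_root_.omniMap, _root_.omniMap, HypergraphCategory.omni_tensor, _root_.inl,
      MonoidalCategory.tensorHom_def, unitors_inv_equal, ← rightUnitor_inv_naturality_assoc]
  compare := by
    have h : (_root_.inl X Y ⊗ₘ _root_.inl X Y) ≫ compareMap (X ⊗ Y) =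
        ((ρ_ X).inv ⊗ₘ (ρ_ X).inv) ≫
          _root_.merge (𝟙 X ⊗ₘ _root_.omniMap Y) (𝟙 X ⊗ₘ _root_.omniMap Y) := by
      rw [comp_merge]
      simp [_root_.merge, _root_.inl]
    have h' : ((ρ_ X).inv ⊗ₘ (ρ_ X).inv) ≫ tensorμ X (𝟙_ C) X (𝟙_ C) ≫
        (X ⊗ X) ◁ (λ_ (𝟙_ C)).hom = (ρ_ (X ⊗ X)).inv := by
      rw [← cancel_mono (ρ_ (X ⊗ X)).hom, Category.assoc, Category.assoc,
        ← rightUnitor_monoidal]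
      simp
    have h₂ : _root_.merge (𝟙 X) (𝟙 X) ⊗ₘ ((λ_ (𝟙_ C)).hom ≫ _root_.omniMap Y) =
        (X ⊗ X) ◁ (λ_ (𝟙_ C)).hom ≫ (compareMap X ▷ 𝟙_ C) ≫ X ◁ _root_.omniMap Y := by
      rw [merge_id_id, ← id_tensorHom, ← id_tensorHom, ← tensorHom_id, tensorHom_comp_tensorHom,
        tensorHom_comp_tensorHom]
      simp only [Category.id_comp, Category.comp_id]
    rw [h, ← tensorμ_merge, merge_omni_left, h₂, reassoc_of% h', _root_.inl,
      rightUnitor_inv_naturality_assoc]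

theorem inr (X Y : C) : IsCompareHom (inr X Y) where
  omni := by
    rw [_root_.omniMap, _root_.omniMap, HypergraphCategory.omni_tensor, _root_.inr,
      MonoidalCategory.tensorHom_def', ← leftUnitor_inv_naturality_assoc]
  compare := by
    have h : (_root_.inr X Y ⊗ₘ _root_.inr X Y) ≫ compareMap (X ⊗ Y) =
        ((λ_ Y).inv ⊗ₘ (λ_ Y).inv) ≫
          _root_.merge (_root_.omniMap X ⊗ₘ 𝟙 Y) (_root_.omniMap X ⊗ₘ 𝟙 Y) := by
      rw [comp_merge]
      simp [_root_.merge, _root_.inr]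
    have h' : ((λ_ Y).inv ⊗ₘ (λ_ Y).inv) ≫ tensorμ (𝟙_ C) Y (𝟙_ C) Y ≫
        (λ_ (𝟙_ C)).hom ▷ (Y ⊗ Y) = (λ_ (Y ⊗ Y)).inv := by
      rw [← cancel_mono (λ_ (Y ⊗ Y)).hom, Category.assoc, Category.assoc,
        ← leftUnitor_monoidal]
      simp
    have h₂ : ((λ_ (𝟙_ C)).hom ≫ _root_.omniMap X) ⊗ₘ _root_.merge (𝟙 Y) (𝟙 Y) =
        (λ_ (𝟙_ C)).hom ▷ (Y ⊗ Y) ≫ (𝟙_ C ◁ compareMap Y) ≫ _root_.omniMap X ▷ Y := by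
      rw [merge_id_id, ← id_tensorHom, ← tensorHom_id, ← tensorHom_id, tensorHom_comp_tensorHom,
        tensorHom_comp_tensorHom]
      simp only [Category.id_comp, Category.comp_id]
    rw [h, ← tensorμ_merge, merge_omni_left, h₂, reassoc_of% h', _root_.inr,
      leftUnitor_inv_naturality_assoc]

end IsCompareHom

/-- The computation rule of the copairing: the second leg, fed with omni, becomes the unit of
compare. Only preservation of omni by that leg matters. -/
theorem inl_merge (f : X ⟶ W) {g : Y ⟶ W} (hg : omniMap Y ≫ g = omniMap W) :
    inl X Y ≫ merge f g = f := by
  rw [inl, Category.assoc, whiskerLeft_merge, hg, merge_omni_right, Iso.inv_hom_id_assoc]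

theorem inr_merge {f : X ⟶ W} (g : Y ⟶ W) (hf : omniMap X ≫ f = omniMap W) :
    inr X Y ≫ merge f g = g := by
  rw [inr, Category.assoc, whiskerRight_merge, hf, merge_omni_left, Iso.inv_hom_id_assoc]

/-- In each component a wire is compared with omni and so survives unchanged. With `merge_comp` this
gives uniqueness of copairings: a compare homomorphism out of `X ⊗ Y` is the merge of its two
restrictions. -/
theorem merge_inl_inr (X Y : C) : merge (inl X Y) (inr X Y) = 𝟙 (X ⊗ Y) := by
  have h : merge (inl X Y) (inr X Y) = ((ρ_ X).inv ⊗ₘ (λ_ Y).inv) ≫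
      merge (𝟙 X ⊗ₘ omniMap Y) (omniMap X ⊗ₘ 𝟙 Y) := by
    rw [comp_merge]; simp [inl, inr]
  have hβ : (β_ (𝟙_ C) (𝟙_ C)).hom = 𝟙 _ := by
    rw [braiding_tensorUnit_left, unitors_equal]; simp
  rw [h, ← tensorμ_merge, merge_omni_left, merge_omni_right]
  simp [tensorμ, hβ]

theorem merge_comp_inl_comp_inr (f : X ⟶ W) (g : Y ⟶ Z) :
    merge (f ≫ inl W Z) (g ≫ inr W Z) = f ⊗ₘ g := by
  rw [← comp_merge, merge_inl_inr, Category.comp_id]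

theorem merge_inl_comp_inr (X : C) (g : Y ⟶ Z) :
    merge (inl X Z) (g ≫ inr X Z) = X ◁ g := by
  rw [← id_tensorHom, ← merge_comp_inl_comp_inr, Category.id_comp]

theorem merge_comp_inl_inr (f : X ⟶ W) (Y : C) :
    merge (f ≫ inl W Y) (inr W Y) = f ▷ Y := by
  rw [← tensorHom_id, ← merge_comp_inl_comp_inr, Category.id_comp]

theorem merge_inl_id (X Z : C) :
    merge (inl X Z) (𝟙 (X ⊗ Z)) = (α_ X X Z).inv ≫ compareMap X ▷ Z := by
  rw [← merge_inl_inr X Z, ← merge_comp_inl_inr, (IsCompareHom.inl X Z).compare, ← merge,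
    merge_assoc, Iso.inv_hom_id_assoc]

/-- Split the identity into its two injections. By commutativity the new wire moves past `X`, and
what remains is a merge inside `Z`. -/
theorem merge_comp_inr_id (X : C) (f : Y ⟶ Z) :
    merge (f ≫ inr X Z) (𝟙 (X ⊗ Z)) = (α_ Y X Z).inv ≫ (β_ Y X).hom ▷ Z ≫ (α_ X Y Z).hom ≫
      X ◁ merge f (𝟙 Z) := by
  rw [← merge_inl_comp_inr, merge_comp (IsCompareHom.inr X Z), Category.id_comp, ← merge_assoc,
    whiskerRight_merge, ← merge_comm, merge_assoc, Iso.inv_hom_id_assoc, merge_inl_inr]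

theorem inl_associator (X Y Z : C) : inl (X ⊗ Y) Z ≫ (α_ X Y Z).hom = X ◁ inl Y Z := by
  simp [inl]

theorem inr_associator (X Y Z : C) :
    inr (X ⊗ Y) Z ≫ (α_ X Y Z).hom = inr Y Z ≫ inr X (Y ⊗ Z) := by
  -- The rearrangement is pure coherence and holds with any points in place of the two omni maps.
  have h (p : 𝟙_ C ⟶ X) (q : 𝟙_ C ⟶ Y) :
      ((λ_ Z).inv ≫ ((λ_ (𝟙_ C)).inv ≫ (p ⊗ₘ q)) ▷ Z) ≫ (α_ X Y Z).hom =
        ((λ_ Z).inv ≫ q ▷ Z) ≫ (λ_ (Y ⊗ Z)).inv ≫ p ▷ (Y ⊗ Z) := by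
    rw [MonoidalCategory.tensorHom_def', Category.assoc, leftUnitor_inv_naturality_assoc]
    simp
  rw [inr, omniMap, HypergraphCategory.omni_tensor]
  exact h _ _

theorem inr_unit (X : C) : inr (𝟙_ C) X = (λ_ X).inv := by
  rw [inr, omniMap, HypergraphCategory.omni_unit]
  simp

theorem inl_unit_left (X : C) : inl (𝟙_ C) X = omniMap X ≫ (λ_ X).inv := by
  rw [inl, leftUnitor_inv_naturality, unitors_inv_equal]

theorem inl_unit_right (X : C) : inl X (𝟙_ C) = (ρ_ X).inv := by
  rw [inl, omniMap, HypergraphCategory.omni_unit]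
  simp

/-! ### The commutative monoid of points -/

variable (W) in
/-- A morphism from the unit to an object. -/
@[ext]
structure Point where
  hom : 𝟙_ C ⟶ W

namespace Point

instance : Mul (Point W) := ⟨fun f g => ⟨(λ_ (𝟙_ C)).inv ≫ merge f.hom g.hom⟩⟩

instance : One (Point W) := ⟨⟨omniMap W⟩⟩

theorem mul_hom (f g : Point W) : (f * g).hom = (λ_ (𝟙_ C)).inv ≫ merge f.hom g.hom := rfl

theorem one_hom : (1 : Point W).hom = omniMap W := rfl

/-- The points of an object form a commutative monoid under comparison. -/
instance : CommMonoid (Point W) where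
  mul_assoc f g h := by
    ext
    simp only [mul_hom]
    rw [← whiskerRight_merge, ← whiskerLeft_merge, merge_assoc]
    simp [unitors_inv_equal]
  one_mul f := by
    ext
    rw [mul_hom, one_hom, merge_omni_left, Iso.inv_hom_id_assoc]
  mul_one f := by
    ext
    rw [mul_hom, one_hom, merge_omni_right, unitors_inv_equal, Iso.inv_hom_id_assoc]
  mul_comm f g := by
    ext
    rw [mul_hom, mul_hom, merge_comm, braiding_tensorUnit_left, Category.assoc, Iso.inv_hom_id_assoc,
      unitors_inv_equal]

/-- Morphisms that preserve compare and omni act on points by monoid homomorphisms. -/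
def map {h : W ⟶ Z} (hh : IsCompareHom h) : Point W →* Point Z where
  toFun f := ⟨f.hom ≫ h⟩
  map_one' := by ext; exact hh.omni
  map_mul' f g := by
    ext
    rw [mul_hom, mul_hom, Category.assoc, merge_comp hh]

end Point

end merge

/-! ### Hypergraph functors preserve merges, injections and products of points -/

theorem HypFunctor.map_merge {C : Type u₁} [Category.{v₁} C] [MonoidalCategory C]
    [HypergraphCategory C] {D : Type u₂} [Category.{v₂} D] [MonoidalCategory D]
    [HypergraphCategory D] (F : HypFunctor C D) {X Y W : C} (f : X ⟶ W) (g : Y ⟶ W) :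
    F.map (merge f g) = eqToHom (F.obj_tensor X Y) ≫ merge (F.map f) (F.map g) := by
  simp [merge, F.map_tensor, F.map_compare]

theorem HypFunctor.map_inl {C : Type u₁} [Category.{v₁} C] [MonoidalCategory C]
    [HypergraphCategory C] [StrictMonoidal C] {D : Type u₂} [Category.{v₂} D] [MonoidalCategory D]
    [HypergraphCategory D] [StrictMonoidal D] (F : HypFunctor C D) (X Y : C) :
    F.map (inl X Y) = inl (F.obj X) (F.obj Y) ≫ eqToHom (F.obj_tensor X Y).symm := by
  rw [inl, inl, ← id_tensorHom, StrictMonoidal.rightUnitor_inv, StrictMonoidal.rightUnitor_inv]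
  simp [F.map_tensor, F.map_omni, eqToHom_map, StrictMonoidal.tensorHom_eqToHom_comp,
    -id_tensorHom]
  simp

theorem HypFunctor.map_inr {C : Type u₁} [Category.{v₁} C] [MonoidalCategory C]
    [HypergraphCategory C] [StrictMonoidal C] {D : Type u₂} [Category.{v₂} D] [MonoidalCategory D]
    [HypergraphCategory D] [StrictMonoidal D] (F : HypFunctor C D) (X Y : C) :
    F.map (inr X Y) = inr (F.obj X) (F.obj Y) ≫ eqToHom (F.obj_tensor X Y).symm := by
  rw [inr, inr, ← tensorHom_id, StrictMonoidal.leftUnitor_inv, StrictMonoidal.leftUnitor_inv]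
  simp [F.map_tensor, F.map_omni, eqToHom_map, StrictMonoidal.eqToHom_comp_tensorHom,
    -tensorHom_id]
  simp

/-- Hypergraph functors act on points by monoid homomorphisms. -/
def HypFunctor.mapPoint {C : Type u₁} [Category.{v₁} C] [MonoidalCategory C]
    [HypergraphCategory C] [StrictMonoidal C] {D : Type u₂} [Category.{v₂} D] [MonoidalCategory D]
    [HypergraphCategory D] [StrictMonoidal D] (F : HypFunctor C D) (W : C) :
    Point W →* Point (F.obj W) where
  toFun f := ⟨eqToHom F.obj_unit.symm ≫ F.map f.hom⟩
  map_one' := by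
    ext
    simp [Point.one_hom, F.map_omni]
  map_mul' f g := by
    ext
    simp only [Point.mul_hom]
    rw [F.map_comp, F.map_merge, StrictMonoidal.leftUnitor_inv,
      StrictMonoidal.leftUnitor_inv, ← comp_merge]
    simp [eqToHom_map, eqToHom_tensorHom_eqToHom_comp]

/-! ### `collect` as a copairing of wires -/

namespace FreeHyp

variable {S : MonSig.{u}}

theorem inl_append (x y z : List S.Ob) :
    inl (word (S := S) (x ++ y)) (word z) ≫
      eqToHom (congrArg word (List.append_assoc x y z)) = word x ◁ inl (word y) (word z) :=
  inl_associator (word (S := S) x) (word y) (word z)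

theorem inr_append (x y z : List S.Ob) :
    inr (word (S := S) (x ++ y)) (word z) ≫
      eqToHom (congrArg word (List.append_assoc x y z)) =
        inr (word y) (word z) ≫ inr (word x) (word (y ++ z)) :=
  inr_associator (word (S := S) x) (word y) (word z)

theorem inr_cons (a : S.Ob) (y z : List S.Ob) :
    inr (word (S := S) (a :: y)) (word z) =
        inr (word y) (word z) ≫ inr (word [a]) (word (y ++ z)) := by
  rw [← inr_append [a] y z]
  exact (Category.comp_id _).symm

theorem inl_cons (a : S.Ob) (y z : List S.Ob) :
    inl (word (S := S) (a :: y)) (word z) = word [a] ◁ inl (word y) (word z) := by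
  rw [← inl_append [a] y z]
  exact (Category.comp_id _).symm

theorem inr_nil (z : List S.Ob) : inr (word (S := S) []) (word z) = 𝟙 (word z) :=
  inr_unit (word z)

variable [LinearOrder S.Ob]

/-- The first wire of `w` labelled `a`, beside omni on all the other wires of `w`. -/
def wire (a : S.Ob) : (w : List S.Ob) → (word (S := S) [a] ⟶ word w)
  | [] => delMap (word [a])
  | b :: w =>
    if h : a = b then eqToHom (by rw [h]) ≫ inl (word [b]) (word w)
    else wire a w ≫ inr (word [b]) (word w)

theorem wire_self (a : S.Ob) (w : List S.Ob) :
    wire (S := S) a (a :: w) = inl (word [a]) (word w) := by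
  rw [wire, dif_pos rfl]
  exact Category.id_comp _

theorem wire_of_ne {a b : S.Ob} (h : a ≠ b) (w : List S.Ob) :
    wire (S := S) a (b :: w) = wire a w ≫ inr (word [b]) (word w) := by
  rw [wire, dif_neg h]
  rfl

/-- Membership excludes the default value of `wire`, a delete map, which need not preserve the
monoid structure. -/
theorem isCompareHom_wire {a : S.Ob} {w : List S.Ob} (h : a ∈ w) :
    IsCompareHom (wire (S := S) a w) := by
  induction w with
  | nil => simp at h
  | cons b w ih =>
    by_cases hab : a = b
    · subst hab
      rw [wire_self]
      exact IsCompareHom.inl _ _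
    · rw [wire_of_ne hab]
      exact (ih (by simpa [hab] using h)).comp (IsCompareHom.inr _ _)

/-- The two recursive clauses of `insertWire`, comparing at the first match and crossing a different
letter, are exactly `merge_inl_id` and `merge_comp_inr_id`. -/
theorem insertWire_eq {a : S.Ob} {w : List S.Ob} (h : a ∈ w) :
    insertWire (S := S) a w = merge (wire a w) (𝟙 (word w)) := by
  induction w with
  | nil => simp at h
  | cons b w ih =>
    by_cases hab : a = b
    · subst hab
      rw [wire_self, insertWire, dif_pos rfl]
      exact (merge_inl_id (word (S := S) [a]) (word w)).symm
    · rw [wire_of_ne hab, insertWire, dif_neg hab, ih (by simpa [hab] using h)]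
      exact (merge_comp_inr_id (word (S := S) [b]) (wire a w)).symm

/-- This replaces the recursion by the copairing; later arguments about `collect` use only `merge`
and `wire`. -/
theorem collect_cons {a : S.Ob} {w : List S.Ob} (h : a ∈ w) (u : List S.Ob) :
    collect (S := S) (a :: u) w = merge (wire a w) (collect u w) := by
  rw [collect, insertWire_eq h]
  exact (whiskerLeft_merge (collect u w) (wire a w) (𝟙 (word w))).trans
    (congrArg _ (Category.comp_id _))

theorem isCompareHom_collect {u w : List S.Ob} (h : u ⊆ w) :
    IsCompareHom (collect (S := S) u w) := by
  induction u with
  | nil => exact IsCompareHom.omniMap _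
  | cons a u ih =>
    rw [List.cons_subset] at h
    rw [collect_cons h.1]
    exact (isCompareHom_wire h.1).merge (ih h.2)

theorem collect_append {u : List S.Ob} (u' : List S.Ob) {w : List S.Ob} (h : u ⊆ w) :
    collect (S := S) (u ++ u') w = merge (collect u w) (collect u' w) := by
  induction u with
  | nil =>
    exact ((merge_omni_left (collect u' w)).trans (Category.id_comp _)).symm
  | cons a u ih =>
    rw [List.cons_subset] at h
    rw [collect_cons h.1]
    refine (collect_cons h.1 (u ++ u')).trans ?_
    rw [ih h.2]
    exact ((merge_assoc (wire a w) (collect u w) (collect u' w)).trans (Category.id_comp _)).symm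

theorem wire_comp_collect {a : S.Ob} {v w : List S.Ob} (h : a ∈ v) (hv : v ⊆ w) :
    wire (S := S) a v ≫ collect v w = wire a w := by
  induction v with
  | nil => simp at h
  | cons b v ih =>
    rw [List.cons_subset] at hv
    rw [collect_cons hv.1]
    by_cases hab : a = b
    · subst hab
      rw [wire_self]
      exact inl_merge (wire a w) (isCompareHom_collect hv.2).omni
    · rw [wire_of_ne hab]
      exact (Category.assoc (wire a v) (inr (word [b]) (word v)) _).trans <|
        (congrArg _ (inr_merge (collect v w) (isCompareHom_wire hv.1).omni)).trans
        (ih (by simpa [hab] using h) hv.2)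

/-- Both sides are copairings over the letters of `u`, and `collect v w` preserves merges, so it
suffices to follow one wire. -/
theorem collect_comp_collect {u v w : List S.Ob} (hu : u ⊆ v) (hv : v ⊆ w) :
    collect (S := S) u v ≫ collect v w = collect u w := by
  induction u with
  | nil => exact (isCompareHom_collect hv).omni
  | cons a u ih =>
    rw [List.cons_subset] at hu
    rw [collect_cons hu.1, collect_cons (hv hu.1)]
    refine (merge_comp (isCompareHom_collect hv) _ _).trans ?_
    rw [wire_comp_collect hu.1 hv, ih hu.2]

theorem wire_append {a : S.Ob} {q : List S.Ob} (h : a ∉ q) (r : List S.Ob) :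
    wire (S := S) a (q ++ r) = wire a r ≫ inr (word q) (word r) := by
  induction q with
  | nil => rw [inr_nil]; exact (Category.comp_id _).symm
  | cons b q ih =>
    rw [List.mem_cons, not_or] at h
    rw [inr_cons]
    refine (wire_of_ne h.1 (q ++ r)).trans ?_
    rw [ih h.2]
    exact Category.assoc _ _ _

/-- A wire goes to the first occurrence of its letter; disjointness makes it skip the whole prefix
`q`. -/
theorem collect_append_right {p q r : List S.Ob} (hpq : p.Disjoint q) (hpr : p ⊆ r) :
    collect (S := S) p (q ++ r) = collect p r ≫ inr (word q) (word r) := by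
  induction p with
  | nil => exact (IsCompareHom.inr (word (S := S) q) (word r)).omni.symm
  | cons a p ih =>
    rw [List.cons_subset] at hpr
    rw [List.disjoint_cons_left] at hpq
    rw [collect_cons hpr.1, collect_cons (List.mem_append_right q hpr.1)]
    exact (congrArg₂ merge (wire_append hpq.1 r) (ih hpq.2 hpr.2)).trans
      (merge_comp (IsCompareHom.inr (word q) (word r)) (wire a r) (collect p r)).symm

/-- Without repetitions each wire of `p` meets its own position. A repeated letter would instead
have its wires compared at the first occurrence. -/
theorem collect_append_left {p : List S.Ob} (hp : p.Nodup) (q : List S.Ob) :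
    collect (S := S) p (p ++ q) = inl (word p) (word q) := by
  induction p with
  | nil => exact ((inl_unit_left (word (S := S) q)).trans (Category.comp_id _)).symm
  | cons a p ih =>
    rw [List.nodup_cons] at hp
    rw [inl_cons]
    refine (collect_cons (List.mem_cons_self (a := a) (l := p ++ q)) p).trans ?_
    have h₁ : collect (S := S) p (a :: (p ++ q)) =
        inl (word p) (word q) ≫ inr (word [a]) (word (p ++ q)) := by
      rw [← ih hp.2]
      exact collect_append_right (q := [a]) (by simpa using hp.1) (List.subset_append_left p q)
    rw [h₁, wire_self]
    exact merge_inl_comp_inr _ _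

theorem collect_congr {u u' w w' : List S.Ob} (hu : u = u') (hw : w = w') :
    collect (S := S) u w =
      eqToHom (congrArg word hu) ≫ collect u' w' ≫ eqToHom (congrArg word hw.symm) := by
  subst hu hw; simp

theorem collect_self {w : List S.Ob} (hw : w.Nodup) : collect (S := S) w w = 𝟙 (word w) := by
  have h := (collect_append_left hw []).trans (inl_unit_right (word (S := S) w))
  rw [collect_congr rfl (List.append_nil w).symm, h, StrictMonoidal.rightUnitor_inv]
  simp only [eqToHom_refl, Category.id_comp]
  exact eqToHom_trans _ _

end FreeHyp

/-! ### Functors that separate letters preserve `collect` -/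

namespace FreeHyp

section objWord

variable {S T : MonSig.{u}} (F : HypFunctor (FreeHyp S) (FreeHyp T))

/-- The word to which a hypergraph functor between free hypergraph categories sends a word. -/
def objWord (w : List S.Ob) : List T.Ob := F.obj (word w)

theorem objWord_append (u w : List S.Ob) : objWord F (u ++ w) = objWord F u ++ objWord F w :=
  F.obj_tensor (word u) (word w)

theorem objWord_subset {u w : List S.Ob} (h : u ⊆ w) : objWord F u ⊆ objWord F w := by
  induction u with
  | nil =>
    have hu : objWord F [] = [] := F.obj_unit
    rw [hu]
    exact List.nil_subset _
  | cons a u ih =>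
    rw [List.cons_subset] at h
    obtain ⟨s, t, rfl⟩ := List.append_of_mem h.1
    have hu : objWord F (a :: u) = objWord F [a] ++ objWord F u := objWord_append F [a] u
    have ht : objWord F (a :: t) = objWord F [a] ++ objWord F t := objWord_append F [a] t
    rw [hu, List.append_subset]
    refine ⟨?_, ih h.2⟩
    rw [objWord_append, ht]
    exact fun x hx => List.mem_append_right _ (List.mem_append_left _ hx)

/-- The letters of the signature are sent to words with distinct letters, different letters of the
signature to disjoint words. -/
structure SeparatesLetters : Prop where
  nodup : ∀ a, (objWord F [a]).Nodup
  disjoint : ∀ a b, a ≠ b → (objWord F [a]).Disjoint (objWord F [b])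

variable {F} [LinearOrder S.Ob] [LinearOrder T.Ob]

/-- The image of a wire is a block of wires. Disjointness makes the block skip the images of earlier
letters, and distinctness puts it in order onto the first block coming from `a`. Repetitions in `w`
do no harm, since both sides use the first occurrence. -/
theorem SeparatesLetters.map_wire (hF : SeparatesLetters F) {a : S.Ob} {w : List S.Ob}
    (h : a ∈ w) : F.map (wire a w) = collect (objWord F [a]) (objWord F w) := by
  induction w with
  | nil => simp at h
  | cons b w ih =>
    have hw : objWord F (b :: w) = objWord F [b] ++ objWord F w := objWord_append F [b] w
    rw [collect_congr rfl hw]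
    by_cases hab : a = b
    · subst hab
      rw [wire_self, collect_append_left (hF.nodup a)]
      exact (F.map_inl (word [a]) (word w)).trans (Category.id_comp _).symm
    · have h' : a ∈ w := by simpa [hab] using h
      rw [wire_of_ne hab, collect_append_right (hF.disjoint a b hab)
        (objWord_subset F (by simpa using h')), ← ih h']
      refine (F.map_comp (wire a w) (inr (word [b]) (word w))).trans ?_
      rw [F.map_inr]
      exact ((Category.id_comp _).trans (Category.assoc _ _ _)).symm

theorem SeparatesLetters.map_collect (hF : SeparatesLetters F) {u w : List S.Ob}
    (h : u ⊆ w) : F.map (collect u w) = collect (objWord F u) (objWord F w) := by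
  induction u with
  | nil =>
    have hu : objWord F [] = [] := F.obj_unit
    rw [collect_congr hu rfl]
    exact (F.map_omni (word w)).trans (congrArg _ (Category.comp_id _).symm)
  | cons a u ih =>
    rw [List.cons_subset] at h
    have hu : objWord F (a :: u) = objWord F [a] ++ objWord F u := objWord_append F [a] u
    rw [collect_cons h.1, collect_congr hu rfl,
      collect_append _ (objWord_subset F (by simpa using h.1)), ← ih h.2, ← hF.map_wire h.1]
    exact (F.map_merge (wire a w) (collect u w)).trans (congrArg _ (Category.comp_id _).symm)

end objWord

/-! ### Compare-composition as a product of points -/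

variable {S : MonSig.{u}} [LinearOrder S.Ob]

/-- A factor, with omni on the letters of `w` that are not among its outputs. -/
def Factor.point (φ : Factor S) (w : List S.Ob) : Point (word (S := S) w) :=
  ⟨φ.hom ≫ collect (sortedList φ.out) w⟩

theorem mem_sortedList {s : Finset S.Ob} {a : S.Ob} : a ∈ sortedList s ↔ a ∈ s :=
  Finset.mem_sort _

theorem sortedList_subset {s : Finset S.Ob} {w : List S.Ob} :
    sortedList s ⊆ w ↔ ∀ a ∈ s, a ∈ w := by
  simp only [List.subset_def, mem_sortedList]

theorem Factor.map_point {φ : Factor S} {v w : List S.Ob} (hv : ∀ a ∈ φ.out, a ∈ v)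
    (hw : v ⊆ w) : Point.map (isCompareHom_collect hw) (φ.point v) = φ.point w := by
  ext
  exact (Category.assoc _ _ _).trans
    (congrArg (φ.hom ≫ ·) (collect_comp_collect (sortedList_subset.2 hv) hw))

/-- Collecting into `w` absorbs the inner `collect` and splits over the concatenation of output
words, so each recursive step of `compComp` becomes one multiplication. -/
theorem compComp_comp_collect (l : List (Factor S)) {w : List S.Ob} (hw : ∀ a ∈ outs l, a ∈ w) :
    compComp l ≫ collect (sortedList (outs l)) w = (l.map fun φ : Factor S => φ.point w).prod.hom := by
  induction l with
  | nil =>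
    have h : sortedList (outs ([] : List (Factor S))) = [] := Finset.sort_empty _
    rw [collect_congr h rfl, compComp, eqToHom_refl, Category.comp_id]
    refine (eqToHom_trans_assoc _ (congrArg word h) _).trans ?_
    exact Category.id_comp _
  | cons φ l ih =>
    have hφ : ∀ a ∈ φ.out, a ∈ outs (φ :: l) := fun a h => Finset.mem_union_left _ h
    have hl : ∀ a ∈ outs l, a ∈ outs (φ :: l) := fun a h => Finset.mem_union_right _ h
    rw [List.map_cons, List.prod_cons, Point.mul_hom, ← ih fun a h => hw a (hl a h), compComp]
    have h₁ : sortedList φ.out ++ sortedList (outs l) ⊆ sortedList (outs (φ :: l)) := by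
      simp only [List.append_subset, sortedList_subset, mem_sortedList]
      exact ⟨hφ, hl⟩
    have h₂ := collect_comp_collect (S := S) h₁ (sortedList_subset.2 hw)
    have h₃ := collect_append (S := S) (sortedList (outs l))
      (sortedList_subset.2 fun a h => hw a (hφ a h))
    refine (Category.assoc _ _ _).trans (congrArg _ ((Category.assoc _ _ _).trans ?_))
    exact (congrArg (_ ≫ ·) (h₂.trans h₃)).trans (comp_merge _ _ _ _)

end FreeHyp

namespace FreeHyp

variable {S T : MonSig.{u}} [LinearOrder S.Ob] [LinearOrder T.Ob]

/-- The value of a hypergraph functor on a factor extended by omni is the value on the factor,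
extended by omni. -/
theorem SeparatesLetters.mapPoint_point {F : HypFunctor (FreeHyp S) (FreeHyp T)}
    (hF : SeparatesLetters F) (φ : Factor S) {w : List S.Ob} (hw : ∀ a ∈ φ.out, a ∈ w) :
    F.mapPoint (word w) (φ.point w) =
      Point.map (isCompareHom_collect (objWord_subset F (sortedList_subset.2 hw)))
        (F.mapPoint (sorted φ.out) ⟨φ.hom⟩) := by
  ext
  refine (congrArg (eqToHom F.obj_unit.symm ≫ ·) ((F.map_comp _ _).trans
    (congrArg (F.map φ.hom ≫ ·) (hF.map_collect (sortedList_subset.2 hw))))).trans ?_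
  exact (Category.assoc _ _ _).symm

/-- Needed because the words being compared, such as those for a composite morphism and for the
iterated preimage, are equal only propositionally. -/
theorem prod_point_hom_congr {ι : Type*} (s : Finset ι) (φ : ι → Factor S) {v w : List S.Ob}
    (h : v = w) : (∏ i ∈ s, (φ i).point v).hom =
      (∏ i ∈ s, (φ i).point w).hom ≫ eqToHom (congrArg word h.symm) := by
  subst h; simp

theorem mem_outs {l : List (Factor S)} {a : S.Ob} : a ∈ outs l ↔ ∃ φ ∈ l, a ∈ φ.out := by
  induction l with
  | nil => simp [outs]
  | cons φ l ih => simp [outs, ih]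

end FreeHyp

/-! ### Fibres, cliques and the functor on ordered graphs -/

namespace OUGr

open FreeHyp

variable {H H' H'' : OUGr.{u}}

theorem mem_preimage {α : H ⟶ H'} {C : Finset H'.V} {x : H.V} :
    x ∈ preimage α C ↔ α.toFun x ∈ C := by
  simp [preimage]

/-- Distinct image vertices come from distinct, hence adjacent, vertices of `D`; as the images
differ, the edge condition leaves only adjacency. This is where that condition enters the proof. -/
theorem image_clique (α : H ⟶ H') (D : H.Clique) :
    (image α D.1).Nonempty ∧ H'.graph.IsClique (image α D.1 : Set H'.V) := by
  refine ⟨D.2.1.image _, ?_⟩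
  rw [image, Finset.coe_image]
  rintro _ ⟨x, hx, rfl⟩ _ ⟨y, hy, rfl⟩ hxy
  exact (α.map_adj x y (D.2.2 hx hy fun h => hxy (congrArg _ h))).resolve_left hxy

/-- The image of a clique. -/
def mapClique (α : H ⟶ H') (D : H.Clique) : H'.Clique := ⟨image α D.1, image_clique α D⟩

noncomputable instance (H : OUGr.{u}) : Fintype H.Clique :=
  @Fintype.ofFinite _ (inferInstanceAs (Finite {_C : Finset H.V // _}))

/-- The word of the vertices mapped to the letters of a word, in the order of the letters. -/
def preimageWord (α : H ⟶ H') (w : List H'.sig.Ob) : List H.sig.Ob :=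
  w.flatMap fun v => sortedList (S := H.sig) (preimage α {v})

theorem mem_preimageWord {α : H ⟶ H'} {w : List H'.sig.Ob} {x : H.sig.Ob} :
    x ∈ preimageWord α w ↔ α.toFun x ∈ w := by
  refine List.mem_flatMap.trans ⟨?_, ?_⟩
  · rintro ⟨v, hv, hx⟩
    have h := Finset.mem_singleton.1 (mem_preimage.1 (mem_sortedList.1 hx))
    exact h ▸ hv
  · exact fun h => ⟨_, h, mem_sortedList.2 (mem_preimage.2 (Finset.mem_singleton_self _))⟩

/-- Within a fibre the order is imposed by sorting; across fibres, `y ≤ x` would contradict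
monotonicity of `α`. This is where monotonicity enters the proof. -/
theorem sortedLT_preimageWord (α : H ⟶ H') {w : List H'.sig.Ob} (hw : w.SortedLT) :
    (preimageWord α w).SortedLT := by
  refine List.Pairwise.sortedLT (List.pairwise_flatMap.2
    ⟨fun a _ => (Finset.sortedLT_sort _).pairwise, hw.pairwise.imp fun {a b} hab x hx y hy => ?_⟩)
  have hx' := Finset.mem_singleton.1 (mem_preimage.1 (mem_sortedList.1 hx))
  have hy' := Finset.mem_singleton.1 (mem_preimage.1 (mem_sortedList.1 hy))
  refine lt_of_not_ge fun hyx => absurd (α.monotone hyx) ?_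
  rw [hx', hy']
  exact not_le_of_gt hab

/-- Two strictly increasing lists with the same elements coincide, so no permutation of the outputs
is needed. -/
theorem preimageWord_sortedList (α : H ⟶ H') (C : Finset H'.V) :
    preimageWord α (sortedList (S := H'.sig) C) = sortedList (S := H.sig) (preimage α C) := by
  refine (sortedLT_preimageWord α (Finset.sortedLT_sort _)).eq_of_mem_iff
    (Finset.sortedLT_sort _) fun x => ?_
  exact mem_preimageWord.trans
    (mem_sortedList.trans (mem_preimage.symm.trans (mem_sortedList (S := H.sig)).symm))

theorem preimageWord_singleton (α : H ⟶ H') (v : H'.V) :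
    preimageWord α [v] = sortedList (S := H.sig) (preimage α {v}) :=
  List.append_nil _

theorem preimageWord_id (w : List H.sig.Ob) : preimageWord (𝟙 H) w = w := by
  have h (v : H.V) : sortedList (S := H.sig) (preimage (𝟙 H) {v}) = [v] := by
    have hv : preimage (𝟙 H) {v} = {v} := by
      ext x
      exact mem_preimage
    rw [hv]
    exact Finset.sort_singleton _ _
  induction w with
  | nil => rfl
  | cons v w ih => exact congrArg₂ (· ++ ·) (h v) ih

theorem preimageWord_comp (α : H ⟶ H') (β : H' ⟶ H'') (w : List H''.sig.Ob) :
    preimageWord (α ≫ β) w = preimageWord α (preimageWord β w) := by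
  have h (v : H''.V) : sortedList (S := H.sig) (preimage (α ≫ β) {v}) =
      preimageWord α (sortedList (S := H'.sig) (preimage β {v})) := by
    rw [preimageWord_sortedList]
    congr 1
    ext x
    simp only [mem_preimage]
    rfl
  induction w with
  | nil => rfl
  | cons v w ih =>
    exact (congrArg₂ (· ++ ·) (h v) ih).trans List.flatMap_append.symm

theorem mem_preimageWord_of_mapClique {α : H ⟶ H'} {D : H.Clique} {C : H'.Clique}
    (h : mapClique α D = C) : ∀ a ∈ D.1, a ∈ preimageWord α (sortedList (S := H'.sig) C.1) := by
  subst h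
  exact fun a ha => mem_preimageWord.2 (mem_sortedList.2 (Finset.mem_image_of_mem α.toFun ha))

/-- The compare-composition of the generators of the cliques mapped onto `C`, with omni on the
vertices mapped into `C` that are in none of these cliques. -/
noncomputable def cliquePoint (α : H ⟶ H') (C : H'.Clique) (w : List H.sig.Ob) :
    Point (word (S := H.sig) w) :=
  open Classical in ∏ D with mapClique α D = C, (H.cliqueFactor D).point w

/-- The interpretation of the signature of `H'` given by a morphism `H ⟶ H'`. -/
noncomputable def interp (α : H ⟶ H') : H'.sig.Interp (FreeHyp H.sig) where
  obj w := word (preimageWord α w)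
  obj_nil := rfl
  obj_append _ _ := congrArg word List.flatMap_append
  gen C := (cliquePoint α C (preimageWord α (sortedList (S := H'.sig) C.1))).hom

/-- The hypergraph functor given by a morphism of ordered graphs. -/
noncomputable def synFunctor (α : H ⟶ H') : HypFunctor (FreeHyp H'.sig) (FreeHyp H.sig) :=
  lift (interp α)

theorem objWord_synFunctor (α : H ⟶ H') (w : List H'.sig.Ob) :
    objWord (synFunctor α) w = preimageWord α w := rfl

theorem separatesLetters_synFunctor (α : H ⟶ H') : SeparatesLetters (synFunctor α) where
  nodup a := by
    rw [objWord_synFunctor]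
    exact (preimageWord_singleton α a).symm ▸ Finset.sort_nodup _ _
  disjoint a b hab x ha hb := by
    rw [objWord_synFunctor] at ha hb
    have h₁ := List.mem_singleton.1 (mem_preimageWord.1 ha)
    have h₂ := List.mem_singleton.1 (mem_preimageWord.1 hb)
    exact hab (h₁.symm.trans h₂)

theorem mapPoint_cliqueFactor (α : H ⟶ H') (C : H'.Clique) :
    (synFunctor α).mapPoint (sorted C.1) ⟨(H'.cliqueFactor C).hom⟩ =
      cliquePoint α C (preimageWord α (sortedList (S := H'.sig) C.1)) := by
  ext
  exact Category.id_comp _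

/-- The generator of a clique is sent to the compare-composition of the cliques mapped onto it;
this holds also after extending both by omni. -/
theorem mapPoint_point (α : H ⟶ H') (C : H'.Clique) {w : List H'.sig.Ob} (hw : ∀ a ∈ C.1, a ∈ w) :
    (synFunctor α).mapPoint (word w) ((H'.cliqueFactor C).point w) =
      cliquePoint α C (preimageWord α w) := by
  classical
  rw [(separatesLetters_synFunctor α).mapPoint_point (H'.cliqueFactor C) hw]
  refine (congrArg _ (mapPoint_cliqueFactor α C)).trans ?_
  rw [cliquePoint, cliquePoint]
  -- Extension by omni is a monoid homomorphism, so it passes to the factors, where extending in two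
  -- stages agrees with extending at once.
  refine (map_prod _ _ _).trans (Finset.prod_congr rfl fun D hD => ?_)
  exact Factor.map_point (φ := H.cliqueFactor D)
    (mem_preimageWord_of_mapClique (Finset.mem_filter.1 hD).2)
    (objWord_subset (synFunctor α) (sortedList_subset.2 hw))

/-- The heart of functoriality: expand each factor by `mapPoint_point`, then recognise the double
product as one product grouped by the intermediate clique. -/
theorem mapPoint_cliquePoint (α : H ⟶ H') (β : H' ⟶ H'') (C : H''.Clique) :
    (synFunctor α).mapPoint (word (preimageWord β (sortedList (S := H''.sig) C.1)))
        (cliquePoint β C (preimageWord β (sortedList (S := H''.sig) C.1))) =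
      cliquePoint (α ≫ β) C (preimageWord α (preimageWord β (sortedList (S := H''.sig) C.1))) := by
  classical
  have h₁ : ∀ D : H'.Clique, D ∈ Finset.univ.filter (fun D => mapClique β D = C) →
      (synFunctor α).mapPoint (word (preimageWord β (sortedList (S := H''.sig) C.1)))
        ((H'.cliqueFactor D).point (preimageWord β (sortedList (S := H''.sig) C.1))) =
      cliquePoint α D (preimageWord α (preimageWord β (sortedList (S := H''.sig) C.1))) := by
    exact fun D hD => mapPoint_point α D
      (mem_preimageWord_of_mapClique (Finset.mem_filter.1 hD).2)
  rw [cliquePoint, cliquePoint]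
  refine (map_prod _ _ _).trans ((Finset.prod_congr rfl h₁).trans ?_)
  have hc (D : H.Clique) : mapClique (α ≫ β) D = mapClique β (mapClique α D) :=
    Subtype.ext (Finset.image_image (s := D.1) (f := α.toFun) (g := β.toFun)).symm
  -- Group the cliques `E` of `H` by their image under `α`, which is a clique of `H'` lying over
  -- `C`.
  rw [← Finset.prod_fiberwise_of_maps_to
    (t := Finset.univ.filter (fun D : H'.Clique => mapClique β D = C)) (g := mapClique α)
    (fun D hD => by simpa [hc] using hD)]
  refine Finset.prod_congr rfl fun D hD => ?_
  -- Since `D` lies over `C`, any `E` with image `D` automatically lies over `C`, and the first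
  -- filter condition is redundant.
  rw [cliquePoint, Finset.filter_filter]
  refine Finset.prod_congr (Finset.filter_congr fun E _ => ?_) fun _ _ => rfl
  rw [hc]
  exact ⟨fun h => ⟨h ▸ (Finset.mem_filter.1 hD).2, h⟩, fun h => h.2⟩

/-- Under the identity only `C` maps onto `C`, and collecting a word without repetitions into itself
changes nothing. -/
theorem cliquePoint_id (C : H.Clique) :
    (cliquePoint (𝟙 H) C (sortedList (S := H.sig) C.1)).hom = gen (S := H.sig) C := by
  classical
  have h : cliquePoint (𝟙 H) C (sortedList (S := H.sig) C.1) =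
      (H.cliqueFactor C).point (sortedList (S := H.sig) C.1) := by
    have h' : Finset.univ.filter (fun D : H.Clique => mapClique (𝟙 H) D = C) = {C} := by
      ext D
      rw [Finset.mem_filter, Finset.mem_singleton,
        show mapClique (𝟙 H) D = D from Subtype.ext Finset.image_id']
      simp
    rw [cliquePoint]
    convert Finset.prod_singleton _ C
  rw [h]
  exact (congrArg (gen (S := H.sig) C ≫ ·)
    (collect_self (S := H.sig) (Finset.sort_nodup C.1 (· ≤ ·)))).trans (Category.comp_id _)

theorem synFunctor_id (H : OUGr.{u}) : synFunctor (𝟙 H) = HypFunctor.id (FreeHyp H.sig) := by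
  refine hypFunctor_ext (funext fun w => preimageWord_id w) fun C => ?_
  refine (prod_point_hom_congr _ _ (preimageWord_id (sortedList (S := H.sig) C.1))).trans ?_
  refine (congrArg (· ≫ _) (cliquePoint_id C)).trans ?_
  exact (Category.id_comp _).symm

theorem synFunctor_comp (α : H ⟶ H') (β : H' ⟶ H'') :
    synFunctor (α ≫ β) = (synFunctor β).comp (synFunctor α) := by
  refine hypFunctor_ext (funext fun w => congrArg word (preimageWord_comp α β w)) fun C => ?_
  have h := congrArg Point.hom (mapPoint_cliquePoint α β C)
  refine (prod_point_hom_congr _ _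
    (preimageWord_comp α β (sortedList (S := H''.sig) C.1))).trans ?_
  refine (congrArg (· ≫ _) h.symm).trans ?_
  exact Category.assoc _ _ _

/-- The contravariant functor sending an ordered graph to the free hypergraph category on its
signature. -/
noncomputable def synPresheaf : OUGr.{u}ᵒᵖ ⥤ HypCat.{u, u} where
  obj H := H.unop.syn
  map α := synFunctor α.unop
  map_id H := synFunctor_id H.unop
  map_comp α β := synFunctor_comp β.unop α.unop

end OUGr

theorem theorem3p6 :
    ∃ (F : OUGr.{u}ᵒᵖ ⥤ HypCat.{u, u}) (hF : ∀ H : OUGr.{u}, F.obj (op H) = H.syn),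
      ∀ {H H' : OUGr.{u}} (α : H ⟶ H'),
        let Fα : HypFunctor (FreeHyp H'.sig) (FreeHyp H.sig) :=
          (eqToHom (hF H').symm ≫ F.map α.op ≫ eqToHom (hF H) : H'.syn ⟶ H.syn)
        (∀ v : H'.V, Fα.obj (FreeHyp.word [v]) = FreeHyp.sorted (OUGr.preimage α {v})) ∧
        ∀ C : H'.Clique,
          ∃ hC : Fα.obj (FreeHyp.sorted C.1) = FreeHyp.sorted (OUGr.preimage α C.1),
            ∀ l : List H.Clique, l.Nodup →
              (∀ D : H.Clique, D ∈ l ↔ OUGr.image α D.1 = C.1) →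
              Fα.map (H'.cliqueFactor C).hom =
                eqToHom Fα.obj_unit ≫ FreeHyp.compComp (l.map H.cliqueFactor) ≫
                  FreeHyp.collect (FreeHyp.sortedList (FreeHyp.outs (l.map H.cliqueFactor)))
                    (FreeHyp.sortedList (OUGr.preimage α C.1)) ≫ eqToHom hC.symm := by
  classical
  refine ⟨OUGr.synPresheaf, fun _ => rfl, fun {H H'} α => ?_⟩
  intro Fα
  -- The object equalities hold by `rfl`, so the transports around `F.map` are identities.
  have hFα : Fα = OUGr.synFunctor α := rfl
  clear_value Fα
  subst hFα
  refine ⟨fun v => congrArg FreeHyp.word (OUGr.preimageWord_singleton α v), fun C =>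
    ⟨congrArg FreeHyp.word (OUGr.preimageWord_sortedList α C.1), fun l hl hlC => ?_⟩⟩
  have hw : ∀ a ∈ FreeHyp.outs (l.map H.cliqueFactor),
      a ∈ FreeHyp.sortedList (S := H.sig) (OUGr.preimage α C.1) := by
    intro a ha
    obtain ⟨φ, hφ, haφ⟩ := FreeHyp.mem_outs.1 ha
    obtain ⟨D, hD, rfl⟩ := List.mem_map.1 hφ
    refine FreeHyp.mem_sortedList.2 (OUGr.mem_preimage.2 ?_)
    exact (hlC D).1 hD ▸ Finset.mem_image_of_mem α.toFun haφ
  have hp := FreeHyp.compComp_comp_collect (l.map H.cliqueFactor) hw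
  -- The list enumerates the cliques over `C` without repetition, so its product of points is the
  -- product defining `cliquePoint`, whatever the order of the list.
  have hl' : Finset.univ.filter (fun D : H.Clique => OUGr.mapClique α D = C) = l.toFinset := by
    ext D
    simp only [Finset.mem_filter, Finset.mem_univ, true_and, List.mem_toFinset, hlC D]
    exact Subtype.ext_iff
  have hq : OUGr.cliquePoint α C (FreeHyp.sortedList (S := H.sig) (OUGr.preimage α C.1)) =
      ((l.map H.cliqueFactor).map fun φ =>
        φ.point (FreeHyp.sortedList (S := H.sig) (OUGr.preimage α C.1))).prod := by
    rw [List.map_map]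
    refine Eq.trans ?_ (List.prod_toFinset _ hl)
    rw [OUGr.cliquePoint, ← hl']
    congr!
  -- The functor produces a concatenation of fibres; transport it to the sorted preimage, which
  -- accounts for `hC`.
  refine (FreeHyp.prod_point_hom_congr _ _ (OUGr.preimageWord_sortedList α C.1)).trans ?_
  refine (congrArg (· ≫ _) ((congrArg Point.hom hq).trans hp.symm)).trans ?_
  exact (Category.assoc _ _ _).trans (Category.id_comp _).symm
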